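/- Let $\mathcal B$ be the braid category: its objects are the natural numbers, $\mathcal B(n,n)=B_n$ is the braid group on $n$ strands and $\mathcal B(n,m)=\emptyset$ for $n\ne m$. It is a strict monoidal category with $m\otimes n=m+n$ and juxtaposition of braids, and it is braided, the braiding $\gamma_{m,n}:m\otimes n\to n\otimes m$ being the braid that passes a block of $n$ strands across a block of $m$ strands. There is a tricategory $T$ (in the sense of Gordon, Power and Street) with one 0-cell and one 1-cell, whose 2-cells are the natural numbers and whose 3-cells $n\to m$ are the elements of $\mathcal B(n,m)$, composed as in $\mathcal B$, such that composition along 1-cells is $\otimes$, and composition along 0-cells is the homomorphism (pseudofunctor) of two variables given by $\otimes$ on 2-cells and 3-cells, with the interchange constraint $$(X_1\otimes X_2)\otimes(Y_1\otimes Y_2)\;\cong\;(X_1\otimes Y_1)\otimes(X_2\otimes Y_2)$$ given by $1\otimes\gamma_{X_2,Y_1}\otimes 1$. This $T$ is a Gray-category: everything in it except interchange is strict (its hom-bicategory is a 2-category, composition along 0-cells is a cubical functor, and the units and all associativity and unit constraints, including the four constraint modifications, are identities). Furthermore, $T$ is not a Penon 3-category in the following sense. Let $\mathcal Q_3$ be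 the category whose objects are maps of magmas $f:A\to B$, where $A$ is a 3-dimensional reflexive globular set with binary compositions, $B$ is a strict 3-category and $f$ is equipped with a contraction: for $m<3$ and parallel $m$-cells $x,y$ of $A$ with $f(x)=f(y)$ a chosen $(m+1)$-cell $[x,y]:x\to y$ with $f([x,y])=1_{f(x)}$ and $[x,x]=1_x$, while parallel 3-cells with the same image under $f$ are equal. Let $P_3$ be the monad on 3-dimensional reflexive globular sets induced by the forgetful functor $(f:A\to B)\mapsto A$ and its left adjoint; a Penon 3-category is a $P_3$-algebra $\theta:P_3X\to X$, with composition $y\circ_k x=\theta(\eta y\circ_k\eta x)$. Then there is no Penon 3-category $X$ with an isomorphism of reflexive globular sets from the underlying reflexive globular set of $T$ to $X$ that carries the composition of 2-cells along 1-cells, of 3-cells along 2-cells and of 3-cells along 1-cells in $T$ to the corresponding compositions in $X$. Hence there are tricategories that are not Penon 3-categories. -/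

import Mathlib

open CategoryTheory

namespace Penon

universe u

/-- An `n`-dimensional reflexive globular set: sets of `m`-cells (none for `m > n`), source and
target maps, and identities `i` in dimensions below `n`. -/
structure RGSet (n : ℕ) where
  cells : ℕ → Type u
  isEmpty_cells : ∀ {m : ℕ}, n < m → IsEmpty (cells m)
  s : ∀ {m : ℕ}, cells (m + 1) → cells m
  t : ∀ {m : ℕ}, cells (m + 1) → cells m
  i : ∀ {m : ℕ}, m < n → cells m → cells (m + 1)
  s_s : ∀ {m : ℕ} (x : cells (m + 2)), s (s x) = s (t x)
  t_s : ∀ {m : ℕ} (x : cells (m + 2)), t (s x) = t (t x)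
  s_i : ∀ {m : ℕ} (h : m < n) (x : cells m), s (i h x) = x
  t_i : ∀ {m : ℕ} (h : m < n) (x : cells m), t (i h x) = x

namespace RGSet

variable {n : ℕ}

/-- Maps of reflexive globular sets. -/
@[ext]
structure Hom (A B : RGSet.{u} n) where
  map : ∀ {m : ℕ}, A.cells m → B.cells m
  map_s : ∀ {m : ℕ} (x : A.cells (m + 1)), map (A.s x) = B.s (map x)
  map_t : ∀ {m : ℕ} (x : A.cells (m + 1)), map (A.t x) = B.t (map x)
  map_i : ∀ {m : ℕ} (h : m < n) (x : A.cells m), map (A.i h x) = B.i h (map x)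

instance : Category (RGSet.{u} n) where
  Hom := Hom
  id A :=
    { map := fun x => x
      map_s := fun _ => rfl
      map_t := fun _ => rfl
      map_i := fun _ _ => rfl }
  comp f g :=
    { map := fun x => g.map (f.map x)
      map_s := fun x => by rw [f.map_s, g.map_s]
      map_t := fun x => by rw [f.map_t, g.map_t]
      map_i := fun h x => by rw [f.map_i, g.map_i] }

/-- `A.Composable k m y x` says that the `m`-cells `x` and `y` match along `k`-cells, that is,
`k < m` and `t ^ (m - k) x = s ^ (m - k) y`. -/
def Composable (A : RGSet.{u} n) (k : ℕ) : ∀ m : ℕ, A.cells m → A.cells m → Prop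
  | 0, _, _ => False
  | m + 1, y, x => if k = m then A.t x = A.s y else Composable A k m (A.s y) (A.t x)

/-- Parallel cells: same source and same target (no condition on `0`-cells). -/
def Parallel (A : RGSet.{u} n) : ∀ m : ℕ, A.cells m → A.cells m → Prop
  | 0, _, _ => True
  | _ + 1, x, y => A.s x = A.s y ∧ A.t x = A.t y

/-- `A.idS k m _ x = i ^ (m - k) (s ^ (m - k) x)` for `k < m`. -/
def idS (A : RGSet.{u} n) (k : ℕ) : ∀ m : ℕ, m ≤ n → A.cells m → A.cells m
  | 0, _, x => x
  | m + 1, h, x => A.i h (if k = m then A.s x else idS A k m (Nat.le_of_succ_le h) (A.s x))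

/-- `A.idT k m _ x = i ^ (m - k) (t ^ (m - k) x)` for `k < m`. -/
def idT (A : RGSet.{u} n) (k : ℕ) : ∀ m : ℕ, m ≤ n → A.cells m → A.cells m
  | 0, _, x => x
  | m + 1, h, x => A.i h (if k = m then A.t x else idT A k m (Nat.le_of_succ_le h) (A.t x))

theorem Composable.map {A B : RGSet.{u} n} (f : Hom A B) {k : ℕ} :
    ∀ {m : ℕ} {y x : A.cells m}, A.Composable k m y x → B.Composable k m (f.map y) (f.map x)
  | 0, _, _, h => h
  | m + 1, y, x, h => by
    unfold Composable at h ⊢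
    split_ifs at h ⊢ with hk
    · rw [← f.map_t, ← f.map_s, h]
    · rw [← f.map_t, ← f.map_s]
      exact Composable.map f h

theorem Parallel.map {A B : RGSet.{u} n} (f : Hom A B) :
    ∀ {m : ℕ} {x y : A.cells m}, A.Parallel m x y → B.Parallel m (f.map x) (f.map y)
  | 0, _, _, _ => trivial
  | m + 1, x, y, h => by
    exact ⟨by rw [← f.map_s, ← f.map_s, h.1], by rw [← f.map_t, ← f.map_t, h.2]⟩

theorem map_idS {A B : RGSet.{u} n} (f : Hom A B) (k : ℕ) :
    ∀ (m : ℕ) (h : m ≤ n) (x : A.cells m), f.map (A.idS k m h x) = B.idS k m h (f.map x)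
  | 0, _, _ => rfl
  | m + 1, h, x => by
    unfold idS
    rw [f.map_i]
    split_ifs with hk
    · rw [f.map_s]
    · rw [map_idS f k m, f.map_s]

theorem map_idT {A B : RGSet.{u} n} (f : Hom A B) (k : ℕ) :
    ∀ (m : ℕ) (h : m ≤ n) (x : A.cells m), f.map (A.idT k m h x) = B.idT k m h (f.map x)
  | 0, _, _ => rfl
  | m + 1, h, x => by
    unfold idT
    rw [f.map_i]
    split_ifs with hk
    · rw [f.map_t]
    · rw [map_idT f k m, f.map_t]

end RGSet

/-- An `n`-dimensional magma: `comp k y x _` is the composite `y ∘ₖ x` of `m`-cells along `k`-cells.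
In this and in the following structures every composability assumption on boundaries or on
composites is a consequence of the assumptions on the cells that are composed first. -/
structure Magma (n : ℕ) extends RGSet.{u} n where
  comp : ∀ (k : ℕ) {m : ℕ} (y x : cells m), toRGSet.Composable k m y x → cells m
  s_comp_self : ∀ {m : ℕ} (y x : cells (m + 1)) (h : toRGSet.Composable m (m + 1) y x),
    s (comp m y x h) = s x
  t_comp_self : ∀ {m : ℕ} (y x : cells (m + 1)) (h : toRGSet.Composable m (m + 1) y x),
    t (comp m y x h) = t y
  s_comp : ∀ {k m : ℕ}, k < m → ∀ (y x : cells (m + 1)) (h : toRGSet.Composable k (m + 1) y x)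
    (h' : toRGSet.Composable k m (s y) (s x)), s (comp k y x h) = comp k (s y) (s x) h'
  t_comp : ∀ {k m : ℕ}, k < m → ∀ (y x : cells (m + 1)) (h : toRGSet.Composable k (m + 1) y x)
    (h' : toRGSet.Composable k m (t y) (t x)), t (comp k y x h) = comp k (t y) (t x) h'

/-- Maps of magmas. -/
@[ext]
structure Magma.Hom {n : ℕ} (A B : Magma.{u} n) extends RGSet.Hom A.toRGSet B.toRGSet where
  map_comp : ∀ (k : ℕ) {m : ℕ} (y x : A.cells m) (h : A.Composable k m y x),
    map (A.comp k y x h) = B.comp k (map y) (map x) (h.map toHom)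

/-- The identity map of a magma. -/
def Magma.Hom.id {n : ℕ} (A : Magma.{u} n) : Magma.Hom A A where
  map x := x
  map_s _ := rfl
  map_t _ := rfl
  map_i _ _ := rfl
  map_comp _ _ _ _ _ := rfl

/-- Composition of maps of magmas. -/
def Magma.Hom.comp {n : ℕ} {A B C : Magma.{u} n} (f : Magma.Hom A B) (g : Magma.Hom B C) :
    Magma.Hom A C where
  map x := g.map (f.map x)
  map_s x := by rw [f.map_s, g.map_s]
  map_t x := by rw [f.map_t, g.map_t]
  map_i h x := by rw [f.map_i, g.map_i]
  map_comp k _ y x h := by rw [f.map_comp, g.map_comp]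

/-- Strict `n`-categories. -/
structure StrictCat (n : ℕ) extends Magma.{u} n where
  assoc : ∀ (k : ℕ) {m : ℕ} (z y x : cells m) (h₁ : toRGSet.Composable k m z y)
    (h₂ : toRGSet.Composable k m y x) (h₃ : toRGSet.Composable k m (comp k z y h₁) x)
    (h₄ : toRGSet.Composable k m z (comp k y x h₂)),
    comp k (comp k z y h₁) x h₃ = comp k z (comp k y x h₂) h₄
  comp_id : ∀ (k : ℕ) {m : ℕ} (hm : m ≤ n) (x : cells m)
    (h : toRGSet.Composable k m x (toRGSet.idS k m hm x)),
    comp k x (toRGSet.idS k m hm x) h = x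
  id_comp : ∀ (k : ℕ) {m : ℕ} (hm : m ≤ n) (x : cells m)
    (h : toRGSet.Composable k m (toRGSet.idT k m hm x) x),
    comp k (toRGSet.idT k m hm x) x h = x
  interchange : ∀ {p k : ℕ}, p < k → ∀ {m : ℕ} (y' y x' x : cells m)
    (h₁ : toRGSet.Composable k m y' y) (h₂ : toRGSet.Composable k m x' x)
    (h₃ : toRGSet.Composable p m (comp k y' y h₁) (comp k x' x h₂))
    (h₄ : toRGSet.Composable p m y' x') (h₅ : toRGSet.Composable p m y x)
    (h₆ : toRGSet.Composable k m (comp p y' x' h₄) (comp p y x h₅)),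
    comp p (comp k y' y h₁) (comp k x' x h₂) h₃ = comp k (comp p y' x' h₄) (comp p y x h₅) h₆
  i_comp : ∀ (k : ℕ) {m : ℕ} (hm : m < n) (y x : cells m) (h : toRGSet.Composable k m y x)
    (h' : toRGSet.Composable k (m + 1) (i hm y) (i hm x)),
    i hm (comp k y x h) = comp k (i hm y) (i hm x) h'

/-- Contractions on a map `f` of `n`-dimensional reflexive globular sets. -/
structure Contraction {n : ℕ} {A B : RGSet.{u} n} (f : RGSet.Hom A B) where
  cell : ∀ {m : ℕ}, m < n → ∀ x y : A.cells m, A.Parallel m x y → f.map x = f.map y →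
    A.cells (m + 1)
  s_cell : ∀ {m : ℕ} (hm : m < n) (x y : A.cells m) (h : A.Parallel m x y)
    (h' : f.map x = f.map y), A.s (cell hm x y h h') = x
  t_cell : ∀ {m : ℕ} (hm : m < n) (x y : A.cells m) (h : A.Parallel m x y)
    (h' : f.map x = f.map y), A.t (cell hm x y h h') = y
  map_cell : ∀ {m : ℕ} (hm : m < n) (x y : A.cells m) (h : A.Parallel m x y)
    (h' : f.map x = f.map y), f.map (cell hm x y h h') = B.i hm (f.map x)
  cell_self : ∀ {m : ℕ} (hm : m < n) (x : A.cells m) (h : A.Parallel m x x),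
    cell hm x x h rfl = A.i hm x
  eq_of_top : ∀ x y : A.cells n, A.Parallel n x y → f.map x = f.map y → x = y

/-- The objects of the category `Q`: a magma over a strict `n`-category, with a contraction. -/
structure Q (n : ℕ) where
  A : Magma.{u} n
  B : StrictCat.{u} n
  f : Magma.Hom A B.toMagma
  con : Contraction f.toHom

namespace Q

variable {n : ℕ}

/-- Morphisms of `Q`: commutative squares that preserve the contraction cells. -/
@[ext]
structure Hom (E E' : Q.{u} n) where
  top : Magma.Hom E.A E'.A
  bot : Magma.Hom E.B.toMagma E'.B.toMagma
  comm : ∀ {m : ℕ} (x : E.A.cells m), E'.f.map (top.map x) = bot.map (E.f.map x)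
  map_con : ∀ {m : ℕ} (hm : m < n) (x y : E.A.cells m) (h : E.A.Parallel m x y)
    (h' : E.f.map x = E.f.map y),
    top.map (E.con.cell hm x y h h') = E'.con.cell hm (top.map x) (top.map y)
      (h.map top.toHom) (by rw [comm, comm, h'])

instance : Category (Q.{u} n) where
  Hom := Hom
  id E :=
    { top := Magma.Hom.id E.A
      bot := Magma.Hom.id E.B.toMagma
      comm := fun _ => rfl
      map_con := fun _ _ _ _ _ => rfl }
  comp F G :=
    { top := F.top.comp G.top
      bot := F.bot.comp G.bot
      comm := fun x => (G.comm _).trans (congrArg G.bot.map (F.comm x))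
      map_con := fun hm x y h h' =>
        (congrArg G.top.map (F.map_con hm x y h h')).trans (G.map_con hm _ _ _ _) }
  id_comp _ := rfl
  comp_id _ := rfl
  assoc _ _ _ := rfl

/-- The forgetful functor from `Q` to reflexive globular sets. -/
def forget (n : ℕ) : Q.{u} n ⥤ RGSet.{u} n where
  obj E := E.A.toRGSet
  map {_ _} (F : Hom _ _) := F.top.toHom

end Q

/-! ### The left adjoint of the forgetful functor

Its value at `X` is the set of formal terms over `X` that can be evaluated in every object of `Q`
under `X`, modulo equality of all the values. -/

section Free

variable {n : ℕ}

/-- The two layers of an object of `Q`. -/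
def Q.lay (E : Q.{u} n) : Bool → Magma.{u} n
  | true => E.A
  | false => E.B.toMagma

/-- Formal terms for the cells of the two layers of the free object on `X`. -/
inductive Tm (X : RGSet.{u} n) : Bool → ℕ → Type u
  | gen {m : ℕ} : X.cells m → Tm X true m
  | s {b : Bool} {m : ℕ} : Tm X b (m + 1) → Tm X b m
  | t {b : Bool} {m : ℕ} : Tm X b (m + 1) → Tm X b m
  | i {b : Bool} {m : ℕ} : Tm X b m → Tm X b (m + 1)
  | comp {b : Bool} {m : ℕ} (k : ℕ) : Tm X b m → Tm X b m → Tm X b m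
  | con {m : ℕ} : Tm X true m → Tm X true m → Tm X true (m + 1)
  | phi {m : ℕ} : Tm X true m → Tm X false m

variable (X : RGSet.{u} n)

/-- Objects of `Q` under `X`. -/
structure Under where
  E : Q.{u} n
  g : RGSet.Hom X E.A.toRGSet

variable {X}

/-- `Ev j x v`: the term `x` has the value `v` in `j`. -/
inductive Ev (j : Under X) : ∀ {b : Bool} {m : ℕ}, Tm X b m → (j.E.lay b).cells m → Prop
  | gen {m : ℕ} (x : X.cells m) : Ev j (b := true) (.gen x) (j.g.map x)
  | s {b : Bool} {m : ℕ} {x : Tm X b (m + 1)} {v : (j.E.lay b).cells (m + 1)} :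
      Ev j x v → Ev j (.s x) ((j.E.lay b).s v)
  | t {b : Bool} {m : ℕ} {x : Tm X b (m + 1)} {v : (j.E.lay b).cells (m + 1)} :
      Ev j x v → Ev j (.t x) ((j.E.lay b).t v)
  | i {b : Bool} {m : ℕ} (hm : m < n) {x : Tm X b m} {v : (j.E.lay b).cells m} :
      Ev j x v → Ev j (.i x) ((j.E.lay b).i hm v)
  | comp {b : Bool} {m : ℕ} (k : ℕ) {y x : Tm X b m} {w v : (j.E.lay b).cells m}
      (h : (j.E.lay b).Composable k m w v) :
      Ev j y w → Ev j x v → Ev j (.comp k y x) ((j.E.lay b).comp k w v h)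
  | con {m : ℕ} (hm : m < n) {y x : Tm X true m} {w v : j.E.A.cells m}
      (h : j.E.A.Parallel m w v) (h' : j.E.f.map w = j.E.f.map v) :
      Ev j (b := true) y w → Ev j (b := true) x v →
      Ev j (b := true) (.con y x) (j.E.con.cell hm w v h h')
  | phi {m : ℕ} {x : Tm X true m} {v : j.E.A.cells m} :
      Ev j (b := true) x v → Ev j (b := false) (.phi x) (j.E.f.map v)

theorem Ev.unique {j : Under X} {b : Bool} {m : ℕ} {x : Tm X b m} {v w : (j.E.lay b).cells m}
    (h : Ev j x v) (h' : Ev j x w) : v = w := by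
  induction h with
  | gen x => cases h'; rfl
  | s _ ih => cases h' with | s h' => rw [ih h']
  | t _ ih => cases h' with | t h' => rw [ih h']
  | i hm _ ih => cases h' with | i _ h' => rw [ih h']
  | comp k h _ _ ih₁ ih₂ =>
    cases h' with | comp _ _ h₁ h₂ => cases ih₁ h₁; cases ih₂ h₂; rfl
  | con hm _ _ _ _ ih₁ ih₂ =>
    cases h' with | con _ _ _ h₁ h₂ => cases ih₁ h₁; cases ih₂ h₂; rfl
  | phi _ ih => cases h' with | phi h' => rw [ih h']

variable (X) in
/-- The terms of dimension at most `n` that have a value in every object of `Q` under `X`. -/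
def DefTm (b : Bool) (m : ℕ) : Type u :=
  {x : Tm X b m // m ≤ n ∧ ∀ j : Under X, ∃ v, Ev j x v}

variable (X) in
/-- Terms with the same values. -/
def defSetoid (b : Bool) (m : ℕ) : Setoid (DefTm X b m) where
  r x y := ∀ j v, Ev j x.1 v ↔ Ev j y.1 v
  iseqv :=
    { refl := fun _ _ _ => Iff.rfl
      symm := fun h j v => (h j v).symm
      trans := fun h h' j v => (h j v).trans (h' j v) }

variable (X) in
/-- The cells of the two layers of the free object on `X`. -/
def Cell (b : Bool) (m : ℕ) : Type u := _root_.Quotient (defSetoid X b m)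

namespace Cell

variable {b : Bool} {m : ℕ}

/-- A term that represents `q`. -/
noncomputable def rep (q : Cell X b m) : Tm X b m := (_root_.Quotient.out q).1

theorem le (q : Cell X b m) : m ≤ n := (_root_.Quotient.out q).2.1

/-- The value of a cell. -/
noncomputable def val (q : Cell X b m) (j : Under X) : (j.E.lay b).cells m :=
  ((_root_.Quotient.out q).2.2 j).choose

theorem ev (q : Cell X b m) (j : Under X) : Ev j q.rep (q.val j) :=
  ((_root_.Quotient.out q).2.2 j).choose_spec

theorem ext {q r : Cell X b m} (h : ∀ j, q.val j = r.val j) : q = r := by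
  refine _root_.Quotient.out_equiv_out.1 fun j v => ?_
  constructor
  · intro hv
    rw [hv.unique (q.ev j), h]
    exact r.ev j
  · intro hv
    rw [hv.unique (r.ev j), ← h]
    exact q.ev j

/-- The cell of a term with given values. -/
def mk (hm : m ≤ n) (x : Tm X b m) (v : ∀ j : Under X, (j.E.lay b).cells m)
    (h : ∀ j, Ev j x (v j)) : Cell X b m :=
  _root_.Quotient.mk _ (⟨x, hm, fun j => ⟨v j, h j⟩⟩ : DefTm X b m)

theorem val_mk (hm : m ≤ n) (x : Tm X b m) (v : ∀ j : Under X, (j.E.lay b).cells m)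
    (h : ∀ j, Ev j x (v j)) (j : Under X) : (mk hm x v h).val j = v j := by
  have h₁ := _root_.Quotient.mk_out (s := defSetoid X b m)
    (⟨x, hm, fun j => ⟨v j, h j⟩⟩ : DefTm X b m)
  exact ((h₁ j _).1 ((mk hm x v h).ev j)).unique (h j)

end Cell

variable (X) in
/-- The reflexive globular sets of cells of the free object on `X`. -/
noncomputable def freeRG (b : Bool) : RGSet.{u} n where
  cells := Cell X b
  isEmpty_cells h := ⟨fun q => absurd q.le (Nat.not_le.2 h)⟩
  s q := .mk (Nat.le_of_succ_le q.le) (.s q.rep) (fun j => (j.E.lay b).s (q.val j))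
    fun j => .s (q.ev j)
  t q := .mk (Nat.le_of_succ_le q.le) (.t q.rep) (fun j => (j.E.lay b).t (q.val j))
    fun j => .t (q.ev j)
  i hm q := .mk hm (.i q.rep) (fun j => (j.E.lay b).i hm (q.val j)) fun j => .i hm (q.ev j)
  s_s q := Cell.ext fun j => by simp only [Cell.val_mk, RGSet.s_s]
  t_s q := Cell.ext fun j => by simp only [Cell.val_mk, RGSet.t_s]
  s_i hm q := Cell.ext fun j => by simp only [Cell.val_mk, RGSet.s_i]
  t_i hm q := Cell.ext fun j => by simp only [Cell.val_mk, RGSet.t_i]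

theorem val_s {b : Bool} {m : ℕ} (q : (freeRG X b).cells (m + 1)) (j : Under X) :
    Cell.val ((freeRG X b).s q) j = (j.E.lay b).s (Cell.val q j) :=
  Cell.val_mk (Nat.le_of_succ_le (Cell.le q)) _ (fun j => (j.E.lay b).s (Cell.val q j)) (fun j => .s (Cell.ev q j)) j

theorem val_t {b : Bool} {m : ℕ} (q : (freeRG X b).cells (m + 1)) (j : Under X) :
    Cell.val ((freeRG X b).t q) j = (j.E.lay b).t (Cell.val q j) :=
  Cell.val_mk (Nat.le_of_succ_le (Cell.le q)) _ (fun j => (j.E.lay b).t (Cell.val q j)) (fun j => .t (Cell.ev q j)) j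

theorem val_i {b : Bool} {m : ℕ} (hm : m < n) (q : (freeRG X b).cells m) (j : Under X) :
    Cell.val ((freeRG X b).i hm q) j = (j.E.lay b).i hm (Cell.val q j) :=
  Cell.val_mk hm _ (fun j => (j.E.lay b).i hm (Cell.val q j)) (fun j => .i hm (Cell.ev q j)) j

/-- Evaluation as a map of reflexive globular sets. -/
noncomputable def valRG (b : Bool) (j : Under X) : RGSet.Hom (freeRG X b) (j.E.lay b).toRGSet where
  map q := Cell.val q j
  map_s q := val_s q j
  map_t q := val_t q j
  map_i hm q := val_i hm q j

theorem freeRG_composable {b : Bool} {k : ℕ} : ∀ {m : ℕ} {y x : (freeRG X b).cells m}, k < m →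
    (∀ j : Under X, (j.E.lay b).Composable k m ((valRG b j).map y) ((valRG b j).map x)) →
    (freeRG X b).Composable k m y x
  | 0, _, _, hk, _ => absurd hk (Nat.not_lt_zero k)
  | m + 1, y, x, hk, h => by
    unfold RGSet.Composable at h ⊢
    split_ifs at h ⊢ with hkm
    · refine Cell.ext fun j => ?_
      have := h j
      rwa [← (valRG b j).map_s, ← (valRG b j).map_t] at this
    · refine freeRG_composable (by omega) fun j => ?_
      rw [(valRG b j).map_s, (valRG b j).map_t]
      exact h j

theorem freeRG_parallel {b : Bool} : ∀ {m : ℕ} {y x : (freeRG X b).cells m},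
    (∀ j : Under X, (j.E.lay b).Parallel m ((valRG b j).map y) ((valRG b j).map x)) →
    (freeRG X b).Parallel m y x
  | 0, _, _, _ => trivial
  | m + 1, y, x, h => by
    refine ⟨Cell.ext fun j => ?_, Cell.ext fun j => ?_⟩
    · have := (h j).1
      rwa [← (valRG b j).map_s, ← (valRG b j).map_s] at this
    · have := (h j).2
      rwa [← (valRG b j).map_t, ← (valRG b j).map_t] at this

theorem lt_of_composable {A : RGSet.{u} n} {k : ℕ} : ∀ {m : ℕ} {y x : A.cells m},
    A.Composable k m y x → k < m
  | 0, _, _, h => h.elim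
  | m + 1, y, x, h => by
    unfold RGSet.Composable at h
    split_ifs at h with hk
    · omega
    · exact Nat.lt_succ_of_lt (lt_of_composable h)

theorem Magma.comp_congr (A : Magma.{u} n) (k : ℕ) {m : ℕ} {y x y' x' : A.cells m}
    (hy : y = y') (hx : x = x') (h : A.Composable k m y x) (h' : A.Composable k m y' x') :
    A.comp k y x h = A.comp k y' x' h' := by
  subst hy hx
  rfl

theorem composable_congr {A : RGSet.{u} n} {k : ℕ} {m : ℕ} {y x y' x' : A.cells m}
    (hy : y = y') (hx : x = x') (h : A.Composable k m y x) : A.Composable k m y' x' := by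
  subst hy hx
  exact h

/-- Composition in the free object. -/
noncomputable def freeComp {b : Bool} (k : ℕ) {m : ℕ} (y x : (freeRG X b).cells m)
    (h : (freeRG X b).Composable k m y x) : (freeRG X b).cells m :=
  Cell.mk (Cell.le x) (.comp k (Cell.rep y) (Cell.rep x))
    (fun j => (j.E.lay b).comp k (Cell.val y j) (Cell.val x j) (h.map (valRG b j)))
    fun j => .comp k _ (Cell.ev y j) (Cell.ev x j)

theorem val_comp {b : Bool} (k : ℕ) {m : ℕ} (y x : (freeRG X b).cells m)
    (h : (freeRG X b).Composable k m y x) (j : Under X) :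
    Cell.val (freeComp k y x h) j =
      (j.E.lay b).comp k (Cell.val y j) (Cell.val x j) (h.map (valRG b j)) :=
  Cell.val_mk _ _
    (fun j => (j.E.lay b).comp k (Cell.val y j) (Cell.val x j) (h.map (valRG b j))) _ j

variable (X) in
/-- The magmas of cells of the free object on `X`. -/
noncomputable def freeMagma (b : Bool) : Magma.{u} n where
  toRGSet := freeRG X b
  comp := freeComp
  s_comp_self y x h := Cell.ext fun j =>
    (val_s _ j).trans ((congrArg (j.E.lay b).s (val_comp _ y x h j)).trans
      (((j.E.lay b).s_comp_self _ _ _).trans (val_s x j).symm))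
  t_comp_self y x h := Cell.ext fun j =>
    (val_t _ j).trans ((congrArg (j.E.lay b).t (val_comp _ y x h j)).trans
      (((j.E.lay b).t_comp_self _ _ _).trans (val_t y j).symm))
  s_comp hk y x h h' := Cell.ext fun j =>
    (val_s _ j).trans <| (congrArg (j.E.lay b).s (val_comp _ y x h j)).trans <|
      ((j.E.lay b).s_comp hk _ _ _
        (composable_congr (val_s y j) (val_s x j) (h'.map (valRG b j)))).trans <|
      ((j.E.lay b).comp_congr _ (val_s y j).symm (val_s x j).symm _ _).trans
      (val_comp _ _ _ h' j).symm
  t_comp hk y x h h' := Cell.ext fun j =>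
    (val_t _ j).trans <| (congrArg (j.E.lay b).t (val_comp _ y x h j)).trans <|
      ((j.E.lay b).t_comp hk _ _ _
        (composable_congr (val_t y j) (val_t x j) (h'.map (valRG b j)))).trans <|
      ((j.E.lay b).comp_congr _ (val_t y j).symm (val_t x j).symm _ _).trans
      (val_comp _ _ _ h' j).symm

variable (X) in
/-- The bottom layer of the free object is a strict `n`-category. -/
noncomputable def freeStrict : StrictCat.{u} n where
  toMagma := freeMagma X false
  assoc k _ z y x h₁ h₂ h₃ h₄ := Cell.ext fun j =>
    (val_comp k _ x h₃ j).trans <|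
      ((j.E.lay false).comp_congr k (val_comp k z y h₁ j) rfl _
        (composable_congr (val_comp k z y h₁ j) rfl (h₃.map (valRG false j)))).trans <|
      (j.E.B.assoc k _ _ _ _ (h₂.map (valRG false j)) _
        (composable_congr rfl (val_comp k y x h₂ j) (h₄.map (valRG false j)))).trans <|
      ((j.E.lay false).comp_congr k rfl (val_comp k y x h₂ j).symm _ _).trans
      (val_comp k z _ h₄ j).symm
  comp_id k m hm x h := Cell.ext fun j =>
    (val_comp k x _ h j).trans <|
      ((j.E.lay false).comp_congr k rfl (RGSet.map_idS (valRG false j) k m hm x) _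
        (composable_congr rfl (RGSet.map_idS (valRG false j) k m hm x)
          (h.map (valRG false j)))).trans
      (j.E.B.comp_id k hm _ _)
  id_comp k m hm x h := Cell.ext fun j =>
    (val_comp k _ x h j).trans <|
      ((j.E.lay false).comp_congr k (RGSet.map_idT (valRG false j) k m hm x) rfl _
        (composable_congr (RGSet.map_idT (valRG false j) k m hm x) rfl
          (h.map (valRG false j)))).trans
      (j.E.B.id_comp k hm _ _)
  interchange {p k} hp _ y' y x' x h₁ h₂ h₃ h₄ h₅ h₆ := Cell.ext fun j =>
    (val_comp p _ _ h₃ j).trans <|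
      ((j.E.lay false).comp_congr p (val_comp k y' y h₁ j) (val_comp k x' x h₂ j) _
        (composable_congr (val_comp k y' y h₁ j) (val_comp k x' x h₂ j)
          (h₃.map (valRG false j)))).trans <|
      (j.E.B.interchange hp _ _ _ _ _ _ _ (h₄.map (valRG false j)) (h₅.map (valRG false j))
        (composable_congr (val_comp p y' x' h₄ j) (val_comp p y x h₅ j)
          (h₆.map (valRG false j)))).trans <|
      ((j.E.lay false).comp_congr k (val_comp p y' x' h₄ j).symm (val_comp p y x h₅ j).symm
        _ _).trans
      (val_comp k _ _ h₆ j).symm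
  i_comp k _ hm y x h h' := Cell.ext fun j =>
    (val_i hm _ j).trans <| (congrArg ((j.E.lay false).i hm) (val_comp k y x h j)).trans <|
      (j.E.B.i_comp k hm _ _ _
        (composable_congr (val_i hm y j) (val_i hm x j) (h'.map (valRG false j)))).trans <|
      ((j.E.lay false).comp_congr k (val_i hm y j).symm (val_i hm x j).symm _ _).trans
      (val_comp k _ _ h' j).symm

/-- The projection of the free object, on cells. -/
noncomputable def phi {m : ℕ} (q : Cell X true m) : Cell X false m :=
  Cell.mk (Cell.le q) (.phi (Cell.rep q)) (fun j => j.E.f.map (Cell.val q j))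
    fun j => .phi (Cell.ev q j)

theorem val_phi {m : ℕ} (q : Cell X true m) (j : Under X) :
    Cell.val (phi q) j = j.E.f.map (Cell.val q j) :=
  Cell.val_mk (b := false) (Cell.le q) _ (fun j => j.E.f.map (Cell.val q j)) (fun j => .phi (Cell.ev q j)) j

variable (X) in
/-- The projection of the free object, as a map of reflexive globular sets. -/
noncomputable def freePhiRG : RGSet.Hom (freeRG X true) (freeRG X false) where
  map q := phi q
  map_s q := Cell.ext fun j =>
    (val_phi _ j).trans <| (congrArg j.E.f.map (val_s q j)).trans <| (j.E.f.map_s _).trans <|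
      (congrArg j.E.B.s (val_phi q j).symm).trans (val_s (b := false) (phi q) j).symm
  map_t q := Cell.ext fun j =>
    (val_phi _ j).trans <| (congrArg j.E.f.map (val_t q j)).trans <| (j.E.f.map_t _).trans <|
      (congrArg j.E.B.t (val_phi q j).symm).trans (val_t (b := false) (phi q) j).symm
  map_i hm q := Cell.ext fun j =>
    (val_phi _ j).trans <| (congrArg j.E.f.map (val_i hm q j)).trans <|
      (j.E.f.map_i hm _).trans <|
      (congrArg (j.E.B.i hm) (val_phi q j).symm).trans (val_i (b := false) hm (phi q) j).symm

variable (X) in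
/-- The projection of the free object. -/
noncomputable def freePhi : Magma.Hom (freeMagma X true) (freeStrict X).toMagma where
  toHom := freePhiRG X
  map_comp k _ y x h := Cell.ext fun j =>
    (val_phi _ j).trans <| (congrArg j.E.f.map (val_comp k y x h j)).trans <|
      (j.E.f.map_comp k _ _ _).trans <|
      (j.E.B.comp_congr k (val_phi y j).symm (val_phi x j).symm _ _).trans
      (val_comp (b := false) k (phi y) (phi x) (h.map (freePhiRG X)) j).symm

theorem phi_eq {m : ℕ} {x y : Cell X true m} (h : phi x = phi y) (j : Under X) :
    j.E.f.map (Cell.val x j) = j.E.f.map (Cell.val y j) := by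
  rw [← val_phi, ← val_phi, h]

/-- The contraction cells of the free object. -/
noncomputable def freeCon {m : ℕ} (hm : m < n) (x y : (freeRG X true).cells m)
    (h : (freeRG X true).Parallel m x y) (h' : phi x = phi y) : (freeRG X true).cells (m + 1) :=
  Cell.mk hm (.con (Cell.rep x) (Cell.rep y))
    (fun j => j.E.con.cell hm (Cell.val x j) (Cell.val y j) (h.map (valRG true j)) (phi_eq h' j))
    fun j => .con hm _ _ (Cell.ev x j) (Cell.ev y j)

theorem val_con {m : ℕ} (hm : m < n) (x y : (freeRG X true).cells m)
    (h : (freeRG X true).Parallel m x y) (h' : phi x = phi y) (j : Under X) :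
    Cell.val (freeCon hm x y h h') j =
      j.E.con.cell hm (Cell.val x j) (Cell.val y j) (h.map (valRG true j)) (phi_eq h' j) :=
  Cell.val_mk (b := true) _ _ (fun j => j.E.con.cell hm (Cell.val x j) (Cell.val y j)
    (h.map (valRG true j)) (phi_eq h' j)) _ j

variable (X) in
/-- The free object of `Q` on `X`. -/
noncomputable def free : Q.{u} n where
  A := freeMagma X true
  B := freeStrict X
  f := freePhi X
  con :=
    { cell := freeCon
      s_cell := fun hm x y h h' => Cell.ext fun j =>
        (val_s _ j).trans <| (congrArg j.E.A.s (val_con hm x y h h' j)).trans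
          (j.E.con.s_cell hm _ _ _ _)
      t_cell := fun hm x y h h' => Cell.ext fun j =>
        (val_t _ j).trans <| (congrArg j.E.A.t (val_con hm x y h h' j)).trans
          (j.E.con.t_cell hm _ _ _ _)
      map_cell := fun hm x y h h' => Cell.ext fun j =>
        (val_phi _ j).trans <| (congrArg j.E.f.map (val_con hm x y h h' j)).trans <|
          (j.E.con.map_cell hm _ _ _ _).trans <|
          (congrArg (j.E.B.i hm) (val_phi x j).symm).trans
          (val_i (b := false) hm (phi x) j).symm
      cell_self := fun hm x h => Cell.ext fun j =>
        (val_con hm x x h rfl j).trans <| (j.E.con.cell_self hm _ _).trans (val_i hm x j).symm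
      eq_of_top := fun _ _ h h' => Cell.ext fun j =>
        j.E.con.eq_of_top _ _ (h.map (valRG true j)) (phi_eq h' j) }

/-- Generators of the free object. -/
def genCell {m : ℕ} (x : X.cells m) : Cell X true m :=
  Cell.mk (not_lt.1 fun h => (X.isEmpty_cells h).false x) (.gen x) (fun j => j.g.map x)
    fun _ => .gen x

theorem val_gen {m : ℕ} (x : X.cells m) (j : Under X) : (genCell x).val j = j.g.map x :=
  Cell.val_mk (b := true) _ _ (fun j => j.g.map x) _ j

variable (X) in
/-- The unit of the free object. -/
def freeUnit : RGSet.Hom X (free X).A.toRGSet where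
  map x := genCell x
  map_s x := Cell.ext fun j =>
    (val_gen _ j).trans <| (j.g.map_s x).trans <|
      (congrArg j.E.A.s (val_gen x j).symm).trans (val_s (b := true) (genCell x) j).symm
  map_t x := Cell.ext fun j =>
    (val_gen _ j).trans <| (j.g.map_t x).trans <|
      (congrArg j.E.A.t (val_gen x j).symm).trans (val_t (b := true) (genCell x) j).symm
  map_i hm x := Cell.ext fun j =>
    (val_gen _ j).trans <| (j.g.map_i hm x).trans <|
      (congrArg (j.E.A.i hm) (val_gen x j).symm).trans (val_i (b := true) hm (genCell x) j).symm

/-- The morphism out of the free object that a map of reflexive globular sets induces. -/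
noncomputable def freeDesc (j : Under X) : Q.Hom (free X) j.E where
  top := { toHom := valRG true j, map_comp := fun k _ y x h => val_comp k y x h j }
  bot := { toHom := valRG false j, map_comp := fun k _ y x h => val_comp k y x h j }
  comm x := (val_phi x j).symm
  map_con hm x y h h' := val_con hm x y h h' j

/-- The two components of a morphism out of the free object. -/
def layMap {E : Q.{u} n} (F : Q.Hom (free X) E) :
    ∀ b : Bool, Magma.Hom (freeMagma X b) (E.lay b)
  | true => F.top
  | false => F.bot

theorem layMap_eq (j : Under X) (F : Q.Hom (free X) j.E)
    (hF : ∀ {m : ℕ} (x : X.cells m), F.top.map (genCell x) = j.g.map x)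
    {b : Bool} {m : ℕ} (x : Tm X b m) : ∀ q : Cell X b m,
    (∀ j, Ev j x (q.val j)) → (layMap F b).map q = q.val j := by
  have key : ∀ {b : Bool} {m : ℕ} (x : Tm X b m) (v : ∀ j : Under X, (j.E.lay b).cells m)
      (_ : ∀ j, Ev j x (v j)), (∀ q : Cell X b m,
      (∀ j, Ev j x (q.val j)) → (layMap F b).map q = q.val j) →
      ∃ q : Cell X b m, (∀ j, q.val j = v j) ∧ (layMap F b).map q = q.val j := by
    intro b m x v hv ih
    refine ⟨Cell.mk (not_lt.1 fun h => ((j.E.lay b).isEmpty_cells h).false (v j)) x v hv,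
      fun j => Cell.val_mk _ _ _ _ j, ih _ fun j => ?_⟩
    rw [Cell.val_mk]
    exact hv j
  induction x with
  | gen x =>
    intro q hq
    have : q = genCell x := Cell.ext fun j => (hq j).unique <| by
      rw [val_gen]; exact .gen x
    subst this
    rw [val_gen]
    exact hF x
  | @s b m x ih =>
    intro q hq
    have : ∀ j, ∃ v, Ev j x v ∧ (j.E.lay b).s v = q.val j := fun j => by
      have := hq j
      generalize q.val j = w at this
      cases this with | s h => exact ⟨_, h, rfl⟩
    choose v hv hv' using this
    obtain ⟨q', h₁, h₂⟩ := key x v hv ih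
    have : q = (freeRG X b).s q' := Cell.ext fun j =>
      ((hv' j).symm.trans (congrArg (j.E.lay b).s (h₁ j).symm)).trans (val_s q' j).symm
    subst this
    exact ((layMap F b).map_s q').trans ((congrArg _ h₂).trans (val_s q' j).symm)
  | @t b m x ih =>
    intro q hq
    have : ∀ j, ∃ v, Ev j x v ∧ (j.E.lay b).t v = q.val j := fun j => by
      have := hq j
      generalize q.val j = w at this
      cases this with | t h => exact ⟨_, h, rfl⟩
    choose v hv hv' using this
    obtain ⟨q', h₁, h₂⟩ := key x v hv ih
    have : q = (freeRG X b).t q' := Cell.ext fun j =>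
      ((hv' j).symm.trans (congrArg (j.E.lay b).t (h₁ j).symm)).trans (val_t q' j).symm
    subst this
    exact ((layMap F b).map_t q').trans ((congrArg _ h₂).trans (val_t q' j).symm)
  | @i b m x ih =>
    intro q hq
    have hm : m < n := q.le
    have : ∀ j, ∃ v, Ev j x v ∧ (j.E.lay b).i hm v = q.val j := fun j => by
      have := hq j
      generalize q.val j = w at this
      cases this with | i _ h => exact ⟨_, h, rfl⟩
    choose v hv hv' using this
    obtain ⟨q', h₁, h₂⟩ := key x v hv ih
    have : q = (freeRG X b).i hm q' := Cell.ext fun j =>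
      ((hv' j).symm.trans (congrArg ((j.E.lay b).i hm) (h₁ j).symm)).trans (val_i hm q' j).symm
    subst this
    exact ((layMap F b).map_i hm q').trans ((congrArg _ h₂).trans (val_i hm q' j).symm)
  | @comp b m k y x ih₁ ih₂ =>
    intro q hq
    have : ∀ j, ∃ w v, Ev j y w ∧ Ev j x v ∧
        ∃ h : (j.E.lay b).Composable k m w v, (j.E.lay b).comp k w v h = q.val j := fun j => by
      have := hq j
      generalize q.val j = w at this
      cases this with | comp _ h h₁ h₂ => exact ⟨_, _, h₁, h₂, h, rfl⟩
    choose w v hw hv hc he using this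
    obtain ⟨q₁, h₁, h₁'⟩ := key y w hw ih₁
    obtain ⟨q₂, h₂, h₂'⟩ := key x v hv ih₂
    have h : (freeRG X b).Composable k m q₁ q₂ :=
      freeRG_composable (lt_of_composable (hc j)) fun j =>
        composable_congr (h₁ j).symm (h₂ j).symm (hc j)
    have : q = freeComp k q₁ q₂ h := Cell.ext fun j =>
      ((he j).symm.trans ((j.E.lay b).comp_congr k (h₁ j).symm (h₂ j).symm _ _)).trans
        (val_comp k q₁ q₂ h j).symm
    subst this
    exact ((layMap F b).map_comp k q₁ q₂ h).trans
      (((j.E.lay b).comp_congr k h₁' h₂' _ _).trans (val_comp k q₁ q₂ h j).symm)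
  | @con m y x ih₁ ih₂ =>
    intro q hq
    have hm : m < n := q.le
    have : ∀ j, ∃ w v : j.E.A.cells m, Ev j (b := true) y w ∧ Ev j (b := true) x v ∧
        ∃ (h : j.E.A.Parallel m w v) (h' : j.E.f.map w = j.E.f.map v),
          j.E.con.cell hm w v h h' = q.val j := fun j => by
      have := hq j
      generalize q.val j = w at this
      cases this with | con _ h h' h₁ h₂ => exact ⟨_, _, h₁, h₂, h, h', rfl⟩
    choose w v hw hv hp hf he using this
    obtain ⟨q₁, h₁, h₁'⟩ := key (b := true) y w hw ih₁
    obtain ⟨q₂, h₂, h₂'⟩ := key (b := true) x v hv ih₂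
    have congr : ∀ (E : Q.{u} n) (w v w' v' : E.A.cells m), w = w' → v = v' →
        ∀ (h₁ : E.A.Parallel m w v) (h₂ : E.f.map w = E.f.map v) (h₁' : E.A.Parallel m w' v')
          (h₂' : E.f.map w' = E.f.map v'), E.con.cell hm w v h₁ h₂ = E.con.cell hm w' v' h₁' h₂' := by
      rintro E w v _ _ rfl rfl _ _ _ _
      rfl
    have h : (freeRG X true).Parallel m q₁ q₂ := freeRG_parallel fun j => by
      change j.E.A.Parallel m (q₁.val j) (q₂.val j)
      rw [h₁, h₂]
      exact hp j
    have h' : phi q₁ = phi q₂ := Cell.ext fun j => by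
      rw [val_phi, val_phi, h₁, h₂]
      exact hf j
    have : q = freeCon hm q₁ q₂ h h' := Cell.ext fun j =>
      ((he j).symm.trans (congr j.E _ _ _ _ (h₁ j).symm (h₂ j).symm _ _ _ _)).trans
        (val_con hm q₁ q₂ h h' j).symm
    subst this
    exact (F.map_con hm q₁ q₂ h h').trans
      ((congr j.E _ _ _ _ h₁' h₂' _ _ _ _).trans (val_con hm q₁ q₂ h h' j).symm)
  | @phi m x ih =>
    intro q hq
    have : ∀ j, ∃ v : j.E.A.cells m, Ev j (b := true) x v ∧ j.E.f.map v = q.val j := fun j => by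
      have := hq j
      generalize q.val j = w at this
      cases this with | phi h => exact ⟨_, h, rfl⟩
    choose v hv hv' using this
    obtain ⟨q', h₁, h₂⟩ := key (b := true) x v hv ih
    have : q = phi q' := Cell.ext fun j => by rw [val_phi, h₁, hv']
    subst this
    exact (F.comm q').symm.trans ((congrArg _ h₂).trans (val_phi q' j).symm)

theorem hom_eq_freeDesc (j : Under X) (F : Q.Hom (free X) j.E)
    (hF : ∀ {m : ℕ} (x : X.cells m), F.top.map (genCell x) = j.g.map x) : F = freeDesc j := by
  refine Q.Hom.ext (Magma.Hom.ext ?_) (Magma.Hom.ext ?_)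
  · funext m q
    exact layMap_eq j F hF (b := true) (Cell.rep q) q (Cell.ev q)
  · funext m q
    exact layMap_eq j F hF (b := false) (Cell.rep q) q (Cell.ev q)

end Free

/-- The forgetful functor from `Q` to reflexive globular sets has a left adjoint. -/
instance (n : ℕ) : (Q.forget.{u} n).IsRightAdjoint :=
  (Adjunction.adjunctionOfEquivLeft (G := Q.forget.{u} n) (F_obj := fun X => free X)
    (fun X E =>
      { toFun := fun F => (show X ⟶ (free X).A.toRGSet from freeUnit X) ≫ (Q.forget n).map F
        invFun := fun g => freeDesc ⟨E, g⟩
        left_inv := fun F => (hom_eq_freeDesc ⟨E, _⟩ F fun _ => rfl).symm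
        right_inv := fun g => RGSet.Hom.ext (by
          funext m x
          exact val_gen x ⟨E, g⟩) })
    (fun X E E' g F => rfl)).isRightAdjoint

/-- The monad `Pₙ` on `n`-dimensional reflexive globular sets. A (reflexive) Penon `n`-category is
an algebra for it. -/
noncomputable def monad (n : ℕ) : Monad (RGSet.{u} n) :=
  (Adjunction.ofIsRightAdjoint (Q.forget.{u} n)).toMonad

/-- The composition of a Penon `n`-category `X`: `y ∘ₖ x` is the image under the structure map
`Pₙ X ⟶ X` of the composite of the generators `y` and `x` in the magma `Pₙ X`. -/
noncomputable def algComp {n : ℕ} (X : (monad.{u} n).Algebra) (k : ℕ) {m : ℕ} (y x : X.A.cells m)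
    (h : X.A.Composable k m y x) : X.A.cells m :=
  X.a.map (((Q.forget n).leftAdjoint.obj X.A).A.comp k (((monad n).η.app X.A).map y)
    (((monad n).η.app X.A).map x) (h.map ((monad n).η.app X.A)))

end Penon

/-- The relations of the braid group on `n` strands, between the generators `σ₀, …, σₙ₋₂`. -/
inductive BraidRel (n : ℕ) : FreeGroup {i : ℕ // i + 1 < n} → Prop
  | comm (i j : {i : ℕ // i + 1 < n}) (h : i.1 + 2 ≤ j.1) :
      BraidRel n (.of i * .of j * (.of j * .of i)⁻¹)
  | braid (i j : {i : ℕ // i + 1 < n}) (h : i.1 + 1 = j.1) :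
      BraidRel n (.of i * .of j * .of i * (.of j * .of i * .of j)⁻¹)

/-- The braid group on `n` strands. -/
abbrev BraidGroup (n : ℕ) : Type := PresentedGroup {r | BraidRel n r}

namespace BraidGroup

/-- The generator `σᵢ` (and `1` if there is none). -/
def σ {n : ℕ} (i : ℕ) : BraidGroup n := if h : i + 1 < n then .of ⟨i, h⟩ else 1

variable {n : ℕ}

theorem σ_comm {i j : ℕ} (h : i + 2 ≤ j) : (σ i * σ j : BraidGroup n) = σ j * σ i := by
  unfold σ
  split_ifs with h₁ h₂
  · rw [← mul_inv_eq_one]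
    exact PresentedGroup.one_of_mem (BraidRel.comm ⟨i, h₁⟩ ⟨j, h₂⟩ h)
  all_goals simp

theorem σ_braid {i : ℕ} (h : i + 2 < n) :
    (σ i * σ (i + 1) * σ i : BraidGroup n) = σ (i + 1) * σ i * σ (i + 1) := by
  have h₁ : i + 1 < n := by omega
  rw [σ, σ, dif_pos h, dif_pos h₁, ← mul_inv_eq_one]
  exact PresentedGroup.one_of_mem (BraidRel.braid ⟨i, h₁⟩ ⟨i + 1, h⟩ rfl)

/-- For `d + n ≤ N`, the inclusion that puts a braid on the strands `d, …, d + n - 1`. -/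
def emb (d : ℕ) {n : ℕ} (N : ℕ) (h : d + n ≤ N) : BraidGroup n →* BraidGroup N :=
  PresentedGroup.toGroup (f := fun i => σ (d + i.1)) (by
    rintro r (⟨i, j, hij⟩ | ⟨i, j, hij⟩)
    · simp only [map_mul, map_inv, FreeGroup.lift_apply_of, mul_inv_eq_one]
      exact σ_comm (by omega)
    · simp only [map_mul, map_inv, FreeGroup.lift_apply_of, mul_inv_eq_one, ← hij]
      have := j.2
      exact σ_braid (by omega))

theorem emb_σ {d N : ℕ} (h : d + n ≤ N) {i : ℕ} (hi : i + 1 < n) :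
    emb d N h (σ i : BraidGroup n) = σ (d + i) := by
  rw [σ, dif_pos hi]
  exact PresentedGroup.toGroup.of _

theorem hom_ext {G : Type*} [Group G] {f g : BraidGroup n →* G}
    (h : ∀ i, i + 1 < n → f (σ i) = g (σ i)) : f = g :=
  PresentedGroup.ext fun i => by
    have := h i.1 i.2
    rwa [σ, dif_pos i.2] at this

theorem emb_self (h : 0 + n ≤ n) (b : BraidGroup n) : emb 0 n h b = b := by
  have : emb 0 n h = MonoidHom.id _ := hom_ext fun i hi => by simp [emb_σ h hi]
  rw [this]
  rfl

theorem emb_emb {d d' e N N' : ℕ} (h : d + n ≤ N) (h' : d' + N ≤ N') (h'' : e + n ≤ N')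
    (he : d' + d = e) (b : BraidGroup n) : emb d' N' h' (emb d N h b) = emb e N' h'' b := by
  have : (emb d' N' h').comp (emb d N h) = emb e N' h'' := hom_ext fun i hi => by
    rw [MonoidHom.comp_apply, emb_σ h hi, emb_σ h'' hi, emb_σ h' (by omega), ← he, add_assoc]
  rw [← this]
  rfl

theorem eq_of_conj {G : Type*} [Group G] {f g : BraidGroup n →* G} (c : G)
    (h : ∀ i, i + 1 < n → f (σ i) * c = c * g (σ i)) (b : BraidGroup n) :
    f b * c = c * g b := by
  have : f = (MulAut.conj c).toMonoidHom.comp g := hom_ext fun i hi => by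
    have := h i hi
    simp [← this]
  rw [this]
  simp

theorem emb_comm {m d e N : ℕ} (h : d + m ≤ N) (h' : e + n ≤ N) (hde : d + m ≤ e)
    (a : BraidGroup m) (b : BraidGroup n) :
    emb d N h a * emb e N h' b = emb e N h' b * emb d N h a := by
  refine eq_of_conj (g := emb d N h) _ (fun i hi => ?_) a
  refine (eq_of_conj (f := emb e N h') (g := emb e N h') _ (fun j hj => ?_) b).symm
  rw [emb_σ h hi, emb_σ h' hj]
  exact (σ_comm (by omega)).symm

/-- The braid `σₒ₊ₘ₋₁ ⋯ σₒ` that moves the strand `o + m` past the `m` strands before it. -/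
def cross (o : ℕ) : ℕ → BraidGroup n
  | 0 => 1
  | m + 1 => σ (o + m) * cross o m

/-- The braid that moves the `k` strands from `o + m` on, in order, past the `m` strands from `o`
on. -/
def block (o m : ℕ) : ℕ → BraidGroup n
  | 0 => 1
  | k + 1 => block o m k * cross (o + k) m

theorem cross_comm_right {o j : ℕ} : ∀ {m : ℕ}, o + m + 1 ≤ j →
    (σ j * cross o m : BraidGroup n) = cross o m * σ j
  | 0, _ => by simp [cross]
  | m + 1, h => by
    rw [cross, ← mul_assoc, ← σ_comm (by omega), mul_assoc, cross_comm_right (by omega), mul_assoc]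

theorem cross_comm_left {o j : ℕ} (h : j + 2 ≤ o) : ∀ {m : ℕ},
    (σ j * cross o m : BraidGroup n) = cross o m * σ j
  | 0 => by simp [cross]
  | m + 1 => by
    rw [cross, ← mul_assoc, σ_comm (by omega), mul_assoc, cross_comm_left h, mul_assoc]

theorem σ_mul_cross {o i : ℕ} (ho : o ≤ i) : ∀ {m : ℕ}, i + 1 < o + m → o + m < n →
    (σ i * cross o m : BraidGroup n) = cross o m * σ (i + 1)
  | 0, h, _ => by omega
  | m + 1, h, hn => by
    rcases Nat.lt_or_ge (i + 1) (o + m) with h' | h'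
    · rw [cross, ← mul_assoc, σ_comm (by omega), mul_assoc, σ_mul_cross ho h' (by omega), mul_assoc]
    · obtain ⟨k, rfl⟩ : ∃ k, m = k + 1 := ⟨m - 1, by omega⟩
      obtain rfl : i = o + k := by omega
      rw [cross, cross, ← add_assoc, ← mul_assoc, ← mul_assoc, σ_braid (by omega), mul_assoc,
        cross_comm_right (by omega)]
      simp only [mul_assoc]

theorem σ_mul_cross_cross {o : ℕ} : ∀ {m : ℕ}, o + m + 1 < n →
    (σ (o + m) * (cross o m * cross (o + 1) m) : BraidGroup n) =
      cross o m * cross (o + 1) m * σ o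
  | 0, _ => by simp [cross]
  | m + 1, h => by
    have e : (cross o (m + 1) * cross (o + 1) (m + 1) : BraidGroup n) =
        σ (o + m) * σ (o + m + 1) * (cross o m * cross (o + 1) m) := by
      rw [cross, cross, show o + 1 + m = o + m + 1 by omega, mul_assoc,
        ← mul_assoc (cross o m), ← cross_comm_right (by omega)]
      simp only [mul_assoc]
    rw [e, mul_assoc _ _ (σ o), ← σ_mul_cross_cross (by omega), ← mul_assoc, ← mul_assoc,
      ← mul_assoc, ← mul_assoc, ← add_assoc, ← σ_braid (by omega)]
    simp only [mul_assoc]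

theorem block_comm {o m j : ℕ} : ∀ {k : ℕ}, o + m + k ≤ j →
    (σ j * block o m k : BraidGroup n) = block o m k * σ j
  | 0, _ => by simp [block]
  | k + 1, h => by
    rw [block, ← mul_assoc, block_comm (by omega), mul_assoc, cross_comm_right (by omega),
      mul_assoc]

theorem σ_mul_block_left {o m i : ℕ} (ho : o ≤ i) (h : i + 1 < o + m) : ∀ {k : ℕ},
    o + m + k ≤ n → (σ i * block o m k : BraidGroup n) = block o m k * σ (i + k)
  | 0, _ => by simp [block]
  | k + 1, hn => by
    rw [block, ← mul_assoc, σ_mul_block_left ho h (by omega), mul_assoc,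
      σ_mul_cross (by omega) (by omega) (by omega), mul_assoc, add_assoc]

theorem σ_mul_block_right {o m j : ℕ} : ∀ {k : ℕ}, j + 1 < k → o + m + k ≤ n →
    (σ (o + m + j) * block o m k : BraidGroup n) = block o m k * σ (o + j)
  | 0, h, _ => by omega
  | k + 1, h, hn => by
    rcases Nat.lt_or_ge (j + 1) k with h' | h'
    · rw [block, ← mul_assoc, σ_mul_block_right h' (by omega), mul_assoc,
        cross_comm_left (by omega), mul_assoc]
    · obtain rfl : k = j + 1 := by omega
      rw [block, block, mul_assoc, ← mul_assoc, block_comm le_rfl, mul_assoc,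
        show o + m + j = o + j + m by omega, ← add_assoc, σ_mul_cross_cross (by omega)]
      simp only [mul_assoc]

theorem block_add {o m k : ℕ} : ∀ l : ℕ,
    (block o m (k + l) : BraidGroup n) = block o m k * block (o + k) m l
  | 0 => by simp [block]
  | l + 1 => by rw [← add_assoc, block, block_add l, block, mul_assoc, add_assoc]

theorem cross_add {o m : ℕ} : ∀ k : ℕ,
    (cross o (m + k) : BraidGroup n) = cross (o + m) k * cross o m
  | 0 => by simp [cross]
  | k + 1 => by rw [← add_assoc, cross, cross_add k, cross, mul_assoc, add_assoc]

theorem block_mul_cross {o m k p : ℕ} (hp : o + m + k ≤ p) : ∀ l : ℕ,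
    (block o m k * cross p l : BraidGroup n) = cross p l * block o m k
  | 0 => by simp [cross]
  | l + 1 => by
    rw [cross, ← mul_assoc, ← block_comm (by omega), mul_assoc, block_mul_cross hp l, mul_assoc]

theorem block_add_left {o m k : ℕ} : ∀ l : ℕ,
    (block o (m + k) l : BraidGroup n) = block (o + m) k l * block o m l
  | 0 => by simp [block]
  | l + 1 => by
    rw [block, block_add_left l, cross_add, block, block, mul_assoc, ← mul_assoc (block o m l),
      block_mul_cross (by omega), show o + m + l = o + l + m by omega]
    simp only [mul_assoc]

theorem emb_cross {d N : ℕ} (h : d + n ≤ N) {o : ℕ} : ∀ {m : ℕ}, o + m < n →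
    emb d N h (cross o m) = cross (d + o) m
  | 0, _ => map_one _
  | m + 1, hm => by
    rw [cross, map_mul, emb_cross h (by omega), emb_σ h (by omega), cross, add_assoc]

theorem emb_block {d N : ℕ} (h : d + n ≤ N) {o m : ℕ} : ∀ {k : ℕ}, o + m + k ≤ n →
    emb d N h (block o m k) = block (d + o) m k
  | 0, _ => map_one _
  | k + 1, hk => by
    rw [block, map_mul, emb_block h (by omega), emb_cross h (by omega), block, add_assoc]

end BraidGroup

section Braids

open BraidGroup

/-- The free braided strict monoidal category on one object: its objects are the natural numbers. -/
@[ext]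
structure BraidCat : Type where
  strands : ℕ

namespace BraidCat

/-- The morphisms `m ⟶ n`: the braids on `m` strands if `m = n`, and none otherwise. -/
@[ext]
structure Hom (m n : BraidCat) : Type where
  eq : m.strands = n.strands
  braid : BraidGroup m.strands

instance : Category BraidCat where
  Hom := Hom
  id _ := ⟨rfl, 1⟩
  comp {m _ _} f g :=
    ⟨f.eq.trans g.eq, f.braid * emb 0 m.strands (by rw [f.eq, zero_add]) g.braid⟩
  id_comp f := Hom.ext (by simp [emb_self])
  comp_id f := Hom.ext (by simp)
  assoc f g h := Hom.ext (by
    rw [map_mul, emb_emb _ _ _ rfl, mul_assoc])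

theorem hom_ext {m n : BraidCat} {f g : m ⟶ n} (h : f.braid = g.braid) : f = g := Hom.ext h

@[simp] theorem id_braid (m : BraidCat) : Hom.braid (𝟙 m) = 1 := rfl

@[simp] theorem comp_braid {m n k : BraidCat} (f : m ⟶ n) (g : n ⟶ k) :
    Hom.braid (f ≫ g) = f.braid * emb 0 m.strands (by rw [f.eq, zero_add]) g.braid := rfl

/-- Isomorphisms from equalities of objects and braids. -/
def isoMk {m n : BraidCat} (h : m.strands = n.strands) (b : BraidGroup m.strands) : m ≅ n where
  hom := ⟨h, b⟩
  inv := ⟨h.symm, emb 0 n.strands (by rw [h, zero_add]) b⁻¹⟩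
  hom_inv_id := hom_ext (by
    simp only [comp_braid]
    rw [emb_emb _ _ (by simp) rfl, emb_self, mul_inv_cancel]
    rfl)
  inv_hom_id := hom_ext (by
    simp only [comp_braid]
    rw [← map_mul, inv_mul_cancel, map_one]
    rfl)

@[simp] theorem isoMk_hom_braid {m n : BraidCat} (h : m.strands = n.strands)
    (b : BraidGroup m.strands) : (isoMk h b).hom.braid = b := rfl

@[simp] theorem isoMk_inv_braid {m n : BraidCat} (h : m.strands = n.strands)
    (b : BraidGroup m.strands) :
    (isoMk h b).inv.braid = emb 0 n.strands (by rw [h, zero_add]) b⁻¹ := rfl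

/-- Juxtaposition of braids. -/
def juxt {m n m' n' : BraidCat} (f : m ⟶ m') (g : n ⟶ n') :
    (⟨m.strands + n.strands⟩ : BraidCat) ⟶ ⟨m'.strands + n'.strands⟩ where
  eq := by rw [f.eq, g.eq]
  braid := emb 0 _ (by omega) f.braid * emb m.strands _ le_rfl g.braid

instance : MonoidalCategoryStruct BraidCat where
  tensorObj m n := ⟨m.strands + n.strands⟩
  tensorUnit := ⟨0⟩
  tensorHom f g := juxt f g
  whiskerLeft m _ _ g := juxt (𝟙 m) g
  whiskerRight f n := juxt f (𝟙 n)
  associator _ _ _ := isoMk (add_assoc _ _ _) 1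
  leftUnitor _ := isoMk (zero_add _) 1
  rightUnitor _ := isoMk (add_zero _) 1

open MonoidalCategory

@[simp] theorem tensorObj_strands (m n : BraidCat) : (m ⊗ n).strands = m.strands + n.strands := rfl

@[simp] theorem unit_strands : (𝟙_ BraidCat).strands = 0 := rfl

@[simp] theorem tensorHom_braid {m n m' n' : BraidCat} (f : m ⟶ m') (g : n ⟶ n') :
    Hom.braid (f ⊗ₘ g) = emb 0 (m.strands + n.strands) (by omega) f.braid *
      emb m.strands (m.strands + n.strands) le_rfl g.braid := rfl

@[simp] theorem whiskerLeft_braid (m : BraidCat) {n n' : BraidCat} (g : n ⟶ n') :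
    Hom.braid (m ◁ g) = emb m.strands (m.strands + n.strands) le_rfl g.braid := by
  change emb 0 _ _ 1 * _ = _
  rw [map_one, one_mul]

@[simp] theorem whiskerRight_braid {m m' : BraidCat} (f : m ⟶ m') (n : BraidCat) :
    Hom.braid (f ▷ n) = emb 0 (m.strands + n.strands) (by omega) f.braid := by
  change _ * emb _ _ _ 1 = _
  rw [map_one, mul_one]

@[simp] theorem associator_hom_braid (m n k : BraidCat) : Hom.braid (α_ m n k).hom = 1 := rfl

@[simp] theorem associator_inv_braid (m n k : BraidCat) : Hom.braid (α_ m n k).inv = 1 :=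
  (isoMk_inv_braid _ _).trans (by rw [inv_one, map_one])

@[simp] theorem leftUnitor_hom_braid (m : BraidCat) : Hom.braid (λ_ m).hom = 1 := rfl

@[simp] theorem rightUnitor_hom_braid (m : BraidCat) : Hom.braid (ρ_ m).hom = 1 := rfl

instance : MonoidalCategory BraidCat := .ofTensorHom
  (id_tensorHom_id := fun _ _ => hom_ext (by simp))
  (id_tensorHom := fun _ _ _ _ => rfl)
  (tensorHom_id := fun _ _ => rfl)
  (tensorHom_comp_tensorHom := fun {X₁ Y₁ Z₁ X₂ Y₂ Z₂} f₁ f₂ g₁ g₂ => hom_ext (by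
    have h₁ := Hom.eq f₁
    have h₂ := Hom.eq f₂
    have h₃ : X₁.strands + Y₂.strands ≤ X₁.strands + X₂.strands := by omega
    have h₄ : 0 + Y₁.strands ≤ X₁.strands + X₂.strands := by omega
    simp only [comp_braid, tensorHom_braid, map_mul, tensorObj_strands]
    rw [emb_emb _ _ h₄ rfl, emb_emb _ _ h₃ (by omega), emb_emb _ _ h₄ rfl, emb_emb _ _ h₃ rfl,
      mul_assoc, mul_assoc, ← mul_assoc (emb X₁.strands _ _ _), ← emb_comm _ _ (by omega),
      mul_assoc]))
  (associator_naturality := fun f₁ f₂ f₃ => hom_ext (by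
    simp only [comp_braid, tensorHom_braid, map_mul, tensorObj_strands, associator_hom_braid,
      map_one, mul_one, one_mul]
    rw [emb_emb _ _ (by omega) rfl, emb_emb _ _ (by omega) rfl, emb_emb _ _ (by omega) rfl,
      emb_emb _ _ (by omega) rfl, emb_emb _ _ (by omega) rfl, emb_emb _ _ (by omega) rfl,
      emb_emb _ _ (by omega) rfl]
    simp only [zero_add, add_zero, mul_assoc]))
  (leftUnitor_naturality := fun f => hom_ext (by
    simp only [comp_braid, tensorHom_braid, id_braid, leftUnitor_hom_braid, map_one, mul_one,
      one_mul, unit_strands, tensorObj_strands]))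
  (rightUnitor_naturality := fun f => hom_ext (by
    simp only [comp_braid, tensorHom_braid, id_braid, rightUnitor_hom_braid, map_one, mul_one,
      one_mul, unit_strands, tensorObj_strands]))
  (pentagon := fun _ _ _ _ => hom_ext (by simp))
  (triangle := fun _ _ => hom_ext (by simp))

/-- The braiding moves the last `n` of `m + n` strands, in order, past the first `m`. -/
def braid (m n : BraidCat) : m ⊗ n ≅ n ⊗ m :=
  isoMk (add_comm _ _) (block 0 m.strands n.strands)

@[simp] theorem braid_hom_braid (m n : BraidCat) :
    Hom.braid (braid m n).hom = block 0 m.strands n.strands := rfl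

instance : BraidedCategory BraidCat where
  braiding := braid
  braiding_naturality_right m {n n'} f := hom_ext (by
    have h := Hom.eq f
    simp only [comp_braid, whiskerLeft_braid, whiskerRight_braid, braid_hom_braid,
      tensorObj_strands]
    rw [emb_emb _ _ (by omega) rfl, emb_block _ (by omega), ← h]
    refine eq_of_conj _ (fun i hi => ?_) _
    rw [emb_σ _ hi, emb_σ _ hi]
    have := σ_mul_block_right (n := m.strands + n.strands) (o := 0) (m := m.strands) hi (by omega)
    simpa using this)
  braiding_naturality_left {m m'} f n := hom_ext (by
    have h := Hom.eq f
    simp only [comp_braid, whiskerLeft_braid, whiskerRight_braid, braid_hom_braid,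
      tensorObj_strands]
    rw [emb_emb _ _ (by omega) rfl, emb_block _ (by omega), ← h]
    refine eq_of_conj _ (fun i hi => ?_) _
    rw [emb_σ _ hi, emb_σ _ hi]
    have := σ_mul_block_left (n := m.strands + n.strands) (o := 0) (i := i) (m := m.strands)
      (k := n.strands) (by omega) (by omega) (by omega)
    simpa [add_comm i] using this)
  hexagon_forward m n k := hom_ext (by
    simp only [comp_braid, whiskerLeft_braid, whiskerRight_braid, braid_hom_braid,
      associator_hom_braid, map_one, mul_one, one_mul, tensorObj_strands]
    rw [emb_block _ (by omega), emb_block _ (by omega), emb_block _ (by omega),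
      emb_block _ (by omega), emb_block _ (by omega), block_add]
    simp)
  hexagon_reverse m n k := hom_ext (by
    simp only [comp_braid, whiskerLeft_braid, whiskerRight_braid, braid_hom_braid,
      associator_inv_braid, map_one, mul_one, one_mul, tensorObj_strands]
    rw [emb_block _ (by omega), emb_block _ (by omega), emb_block _ (by omega),
      emb_block _ (by omega), emb_block _ (by omega), block_add_left]
    simp)

end BraidCat

end Braids

section BraidedComp
open MonoidalCategory CategoryTheory.Prod

universe v u

section
variable {C : Type u} [Category.{v} C] [MonoidalCategory C] [BraidedCategory C]

theorem tensorδ_whiskerLeft (X₁ X₂ : C) {Y₁ Y₂ Z₁ Z₂ : C} (f₁ : Y₁ ⟶ Z₁) (f₂ : Y₂ ⟶ Z₂) :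
    (X₁ ◁ f₁) ⊗ₘ (X₂ ◁ f₂) =
      tensorδ X₁ X₂ Y₁ Y₂ ≫ (X₁ ⊗ X₂) ◁ (f₁ ⊗ₘ f₂) ≫ tensorμ X₁ X₂ Z₁ Z₂ := by
  rw [tensorμ_natural_right, tensorδ_tensorμ_assoc]

theorem tensorδ_whiskerRight {X₁ X₂ Y₁ Y₂ : C} (f₁ : X₁ ⟶ Y₁) (f₂ : X₂ ⟶ Y₂) (Z₁ Z₂ : C) :
    (f₁ ▷ Z₁) ⊗ₘ (f₂ ▷ Z₂) =
      tensorδ X₁ X₂ Z₁ Z₂ ≫ (f₁ ⊗ₘ f₂) ▷ (Z₁ ⊗ Z₂) ≫ tensorμ Y₁ Y₂ Z₁ Z₂ := by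
  rw [tensorμ_natural_left, tensorδ_tensorμ_assoc]

theorem tensorδ_associator (X₁ X₂ Y₁ Y₂ Z₁ Z₂ : C) :
    (α_ X₁ Y₁ Z₁).hom ⊗ₘ (α_ X₂ Y₂ Z₂).hom =
      tensorδ (X₁ ⊗ Y₁) (X₂ ⊗ Y₂) Z₁ Z₂ ≫ tensorδ X₁ X₂ Y₁ Y₂ ▷ (Z₁ ⊗ Z₂) ≫
        (α_ (X₁ ⊗ X₂) (Y₁ ⊗ Y₂) (Z₁ ⊗ Z₂)).hom ≫ (X₁ ⊗ X₂) ◁ tensorμ Y₁ Y₂ Z₁ Z₂ ≫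
        tensorμ X₁ X₂ (Y₁ ⊗ Z₁) (Y₂ ⊗ Z₂) := by
  rw [← tensor_associativity, ← comp_whiskerRight_assoc, tensorδ_tensorμ, id_whiskerRight,
    Category.id_comp, tensorδ_tensorμ_assoc]

theorem tensorδ_leftUnitor (X₁ X₂ : C) :
    (λ_ X₁).hom ⊗ₘ (λ_ X₂).hom =
      tensorδ (𝟙_ C) (𝟙_ C) X₁ X₂ ≫ (λ_ (𝟙_ C)).hom ▷ (X₁ ⊗ X₂) ≫ (λ_ (X₁ ⊗ X₂)).hom := by
  rw [tensor_left_unitality, ← comp_whiskerRight_assoc, Iso.hom_inv_id, id_whiskerRight,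
    Category.id_comp, tensorδ_tensorμ_assoc]

theorem tensorδ_rightUnitor (X₁ X₂ : C) :
    (ρ_ X₁).hom ⊗ₘ (ρ_ X₂).hom =
      tensorδ X₁ X₂ (𝟙_ C) (𝟙_ C) ≫ (X₁ ⊗ X₂) ◁ (λ_ (𝟙_ C)).hom ≫ (ρ_ (X₁ ⊗ X₂)).hom := by
  rw [tensor_right_unitality, ← whiskerLeft_comp_assoc, Iso.hom_inv_id, whiskerLeft_id,
    Category.id_comp, tensorδ_tensorμ_assoc]

end

open Bicategory in
/-- For a braided monoidal category `C`, the tensor product as a pseudofunctor of two variables on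
the one-object bicategory of `C` (whose 1-cells are the objects of `C`, composed by `⊗`). The
comparison of `(X₁ ⊗ X₂) ⊗ (Y₁ ⊗ Y₂)` with `(X₁ ⊗ Y₁) ⊗ (X₂ ⊗ Y₂)` is the braiding
`X₂ ⊗ Y₁ ⟶ Y₁ ⊗ X₂` of the inner factors. -/
def braidedComp (C : Type u) [Category.{v} C] [MonoidalCategory C] [BraidedCategory C] :
    (MonoidalSingleObj C × MonoidalSingleObj C) ⥤ᵖ MonoidalSingleObj C where
  obj _ := MonoidalSingleObj.star C
  map f := tensorObj (C := C) f.1 f.2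
  map₂ η := tensorHom (C := C) η.1 η.2
  map₂_id _ := id_tensorHom_id (C := C) _ _
  map₂_comp _ _ := (tensorHom_comp_tensorHom (C := C) _ _ _ _).symm
  mapId _ := leftUnitor (C := C) (tensorUnit C)
  mapComp f g :=
    { hom := tensorδ (C := C) f.1 f.2 g.1 g.2
      inv := tensorμ (C := C) f.1 f.2 g.1 g.2
      hom_inv_id := tensorδ_tensorμ (C := C) _ _ _ _
      inv_hom_id := tensorμ_tensorδ (C := C) _ _ _ _ }
  map₂_whisker_left _ _ _ _ := tensorδ_whiskerLeft (C := C) _ _ _ _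
  map₂_whisker_right _ _ := tensorδ_whiskerRight (C := C) _ _ _ _
  map₂_associator _ _ _ := tensorδ_associator (C := C) _ _ _ _ _ _
  map₂_left_unitor _ := tensorδ_leftUnitor (C := C) _ _
  map₂_right_unitor _ := tensorδ_rightUnitor (C := C) _ _

end BraidedComp

section Tri

universe u

section Bicat

open Bicategory CategoryTheory.Prod

variable {A B C D : Type u} [Bicategory.{u, u} A] [Bicategory.{u, u} B] [Bicategory.{u, u} C]
  [Bicategory.{u, u} D]

/-- The product of two pseudofunctors. -/
def prodMap (F : A ⥤ᵖ B) (G : C ⥤ᵖ D) : (A × C) ⥤ᵖ (B × D) where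
  obj X := (F.obj X.1, G.obj X.2)
  map f := F.map f.1 ×ₘ G.map f.2
  map₂ η := F.map₂ η.1 ×ₘ G.map₂ η.2
  map₂_id _ := Prod.ext (F.map₂_id _) (G.map₂_id _)
  map₂_comp _ _ := Prod.ext (F.map₂_comp _ _) (G.map₂_comp _ _)
  mapId X := Iso.prod (F.mapId X.1) (G.mapId X.2)
  mapComp f g := Iso.prod (F.mapComp f.1 g.1) (G.mapComp f.2 g.2)
  map₂_whisker_left _ _ _ _ := Prod.ext (F.map₂_whisker_left _ _) (G.map₂_whisker_left _ _)
  map₂_whisker_right _ _ := Prod.ext (F.map₂_whisker_right _ _) (G.map₂_whisker_right _ _)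
  map₂_associator _ _ _ := Prod.ext (F.map₂_associator _ _ _) (G.map₂_associator _ _ _)
  map₂_left_unitor _ := Prod.ext (F.map₂_left_unitor _) (G.map₂_left_unitor _)
  map₂_right_unitor _ := Prod.ext (F.map₂_right_unitor _) (G.map₂_right_unitor _)

variable (A B C) in
/-- Reassociation of a product of three bicategories. -/
def prodAssoc : ((A × B) × C) ⥤ᵖ (A × (B × C)) where
  obj X := (X.1.1, (X.1.2, X.2))
  map f := f.1.1 ×ₘ (f.1.2 ×ₘ f.2)
  map₂ η := η.1.1 ×ₘ (η.1.2 ×ₘ η.2)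
  mapId _ := Iso.refl _
  mapComp _ _ := Iso.refl _

/-- The terminal bicategory. -/
abbrev OneBicat : Type u := LocallyDiscrete (Discrete PUnit.{u + 1})

/-- Its object. -/
abbrev OneBicat.star : OneBicat.{u} := ⟨⟨⟨⟩⟩⟩

/-- Squares that commute up to an isomorphism are pasted along a common side. -/
def paste {x₀ x₁ x₂ y₀ y₁ y₂ : A} {f : x₀ ⟶ y₀} {f' : x₁ ⟶ y₁} {f'' : x₂ ⟶ y₂} {x : x₀ ⟶ x₁}
    {x' : x₁ ⟶ x₂} {y : y₀ ⟶ y₁} {y' : y₁ ⟶ y₂} (S : f ≫ y ≅ x ≫ f') (T : f' ≫ y' ≅ x' ≫ f'') :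
    f ≫ y ≫ y' ≅ (x ≫ x') ≫ f'' :=
  (α_ _ _ _).symm ≪≫ whiskerRightIso S y' ≪≫ α_ _ _ _ ≪≫ whiskerLeftIso x T ≪≫ (α_ _ _ _).symm

/-- The identity square of a 1-cell. -/
def idSq {x y : A} (f : x ⟶ y) : f ≫ 𝟙 y ≅ 𝟙 x ≫ f := ρ_ f ≪≫ (λ_ f).symm

/-- The image under a pseudofunctor of two variables of a pair of squares. -/
def mapSq (F : (A × B) ⥤ᵖ C) {x x' y y' : A} {f : x ⟶ y} {f' : x' ⟶ y'} {p : x ⟶ x'} {q : y ⟶ y'}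
    {z z' w w' : B} {g : z ⟶ w} {g' : z' ⟶ w'} {r : z ⟶ z'} {s : w ⟶ w'}
    (S : f ≫ q ≅ p ≫ f') (T : g ≫ s ≅ r ≫ g') :
    F.map (f ×ₘ g) ≫ F.map (q ×ₘ s) ≅ F.map (p ×ₘ r) ≫ F.map (f' ×ₘ g') :=
  (F.mapComp (f ×ₘ g) (q ×ₘ s)).symm ≪≫ F.map₂Iso (Iso.prod S T) ≪≫ F.mapComp (p ×ₘ r) (f' ×ₘ g')

/-- The image of a composite of three 1-cells under a pseudofunctor. -/
def mapComp₃ (F : A ⥤ᵖ B) {x y z w : A} (f : x ⟶ y) (g : y ⟶ z) (h : z ⟶ w) :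
    F.map (f ≫ g ≫ h) ≅ F.map f ≫ F.map g ≫ F.map h :=
  F.mapComp f (g ≫ h) ≪≫ whiskerLeftIso (F.map f) (F.mapComp g h)

end Bicat

open Bicategory CategoryTheory.Prod
open scoped Pseudofunctor.StrongTrans

/-- The objects `Obj`, the hom-bicategories `Hom a b`, the composition, the units and the
associativity and unit adjoint equivalences of a tricategory. Composition is written in the
order `g ⊗ f` for `f : Hom a b` and `g : Hom b c`. -/
structure TriData (Obj : Type u) (Hom : Obj → Obj → Type u) [∀ a b, Bicategory.{u, u} (Hom a b)] where
  comp (a b c : Obj) : (Hom b c × Hom a b) ⥤ᵖ Hom a c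
  unit (a : Obj) : OneBicat.{u} ⥤ᵖ Hom a a
  assoc (a b c d : Obj) : Bicategory.Equivalence
    ((prodMap (comp b c d) (.id (Hom a b))).comp (comp a b d))
    ((prodAssoc (Hom c d) (Hom b c) (Hom a b)).comp
      ((prodMap (.id (Hom c d)) (comp a b c)).comp (comp a c d)))
  left (a b : Obj) : Bicategory.Equivalence
    ((Bicategory.Prod.sectR OneBicat.star (Hom a b)).toPseudofunctor.comp
      ((prodMap (unit b) (.id (Hom a b))).comp (comp a b b)))
    (Pseudofunctor.id (Hom a b))
  right (a b : Obj) : Bicategory.Equivalence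
    ((Bicategory.Prod.sectL (Hom a b) OneBicat.star).toPseudofunctor.comp
      ((prodMap (.id (Hom a b)) (unit a)).comp (comp a a b)))
    (Pseudofunctor.id (Hom a b))

namespace TriData

variable {Obj : Type u} {Hom : Obj → Obj → Type u} [∀ a b, Bicategory.{u, u} (Hom a b)]
  (D : TriData Obj Hom) {a b c d e : Obj}

/-- `g ⊗ f`. -/
abbrev o (g : Hom b c) (f : Hom a b) : Hom a c := (D.comp a b c).obj (g, f)

/-- `γ ⊗ φ`, for 2-cells. -/
abbrev m {g g' : Hom b c} {f f' : Hom a b} (γ : g ⟶ g') (φ : f ⟶ f') : D.o g f ⟶ D.o g' f' :=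
  (D.comp a b c).map (γ ×ₘ φ)

variable (a) in
/-- The unit 1-cell. -/
abbrev I : Hom a a := (D.unit a).obj OneBicat.star

variable (a) in
/-- The 2-cell of the unit. -/
abbrev ι : D.I a ⟶ D.I a := (D.unit a).map (𝟙 OneBicat.star)

/-- `- ⊗ f`. -/
abbrev R (c : Obj) (f : Hom a b) : Hom b c ⥤ᵖ Hom a c :=
  (Bicategory.Prod.sectL (Hom b c) f).toPseudofunctor.comp (D.comp a b c)

/-- `g ⊗ -`. -/
abbrev L (a : Obj) (g : Hom b c) : Hom a b ⥤ᵖ Hom a c :=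
  (Bicategory.Prod.sectR g (Hom a b)).toPseudofunctor.comp (D.comp a b c)

/-- The associativity 2-cell `(h ⊗ g) ⊗ f ⟶ h ⊗ (g ⊗ f)`. -/
def A (h : Hom c d) (g : Hom b c) (f : Hom a b) : D.o (D.o h g) f ⟶ D.o h (D.o g f) :=
  (D.assoc a b c d).hom.app ((h, g), f)

/-- The left unit 2-cell `I ⊗ f ⟶ f`. -/
def l (f : Hom a b) : D.o (D.I b) f ⟶ f := (D.left a b).hom.app f

/-- The adjoint inverse `f ⟶ f ⊗ I` of the right unit 2-cell. -/
def r' (f : Hom a b) : f ⟶ D.o f (D.I a) := (D.right a b).inv.app f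

/-- Naturality of `A`. -/
def natA {h h' : Hom c d} {g g' : Hom b c} {f f' : Hom a b} (χ : h ⟶ h') (γ : g ⟶ g')
    (φ : f ⟶ f') :
    D.m (D.m χ γ) φ ≫ D.A h' g' f' ≅ D.A h g f ≫ D.m χ (D.m γ φ) :=
  (D.assoc a b c d).hom.naturality ((χ ×ₘ γ) ×ₘ φ)

/-- Naturality of `l`. -/
def natL {f f' : Hom a b} (φ : f ⟶ f') : D.m (D.ι b) φ ≫ D.l f' ≅ D.l f ≫ φ :=
  (D.left a b).hom.naturality φ

/-- Naturality of `r'`. -/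
def natR' {f f' : Hom a b} (φ : f ⟶ f') : φ ≫ D.r' f' ≅ D.r' f ≫ D.m φ (D.ι a) :=
  (D.right a b).inv.naturality φ

/-- Naturality of `A` in its first variable. -/
def natA₁ {h h' : Hom c d} (χ : h ⟶ h') (g : Hom b c) (f : Hom a b) :
    D.m (D.m χ (𝟙 g)) (𝟙 f) ≫ D.A h' g f ≅ D.A h g f ≫ D.m χ (𝟙 (D.o g f)) :=
  D.natA χ (𝟙 g) (𝟙 f) ≪≫ whiskerLeftIso (D.A h g f)
    ((D.comp a c d).map₂Iso (Iso.prod (Iso.refl χ) ((D.comp a b c).mapId (g, f))))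

/-- Naturality of `A` in its second variable. -/
def natA₂ (h : Hom c d) {g g' : Hom b c} (γ : g ⟶ g') (f : Hom a b) :
    D.m (D.m (𝟙 h) γ) (𝟙 f) ≫ D.A h g' f ≅ D.A h g f ≫ D.m (𝟙 h) (D.m γ (𝟙 f)) :=
  D.natA (𝟙 h) γ (𝟙 f)

/-- Naturality of `A` in its third variable. -/
def natA₃ (h : Hom c d) (g : Hom b c) {f f' : Hom a b} (φ : f ⟶ f') :
    D.m (𝟙 (D.o h g)) φ ≫ D.A h g f' ≅ D.A h g f ≫ D.m (𝟙 h) (D.m (𝟙 g) φ) :=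
  whiskerRightIso ((D.comp a b d).map₂Iso (Iso.prod ((D.comp b c d).mapId (h, g)).symm
    (Iso.refl φ))) (D.A h g f') ≪≫ D.natA (𝟙 h) (𝟙 g) φ

end TriData

/-- The remaining data of a tricategory: the components of the four invertible modifications. -/
structure TriModData (Obj : Type u) (Hom : Obj → Obj → Type u)
    [∀ a b, Bicategory.{u, u} (Hom a b)] extends TriData Obj Hom where
  π {a b c d e : Obj} (k : Hom d e) (h : Hom c d) (g : Hom b c) (f : Hom a b) :
    toTriData.m (toTriData.A k h g) (𝟙 f) ≫ toTriData.A k (toTriData.o h g) f ≫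
        toTriData.m (𝟙 k) (toTriData.A h g f) ≅
      toTriData.A (toTriData.o k h) g f ≫ toTriData.A k h (toTriData.o g f)
  μ {a b c : Obj} (g : Hom b c) (f : Hom a b) :
    toTriData.m (toTriData.r' g) (𝟙 f) ≫ toTriData.A g (toTriData.I b) f ≫
        toTriData.m (𝟙 g) (toTriData.l f) ≅
      𝟙 (toTriData.o g f)
  lam {a b c : Obj} (g : Hom b c) (f : Hom a b) :
    toTriData.m (toTriData.l g) (𝟙 f) ≅
      toTriData.A (toTriData.I c) g f ≫ toTriData.l (toTriData.o g f)
  rho {a b c : Obj} (g : Hom b c) (f : Hom a b) :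
    toTriData.m (𝟙 g) (toTriData.r' f) ≅
      toTriData.r' (toTriData.o g f) ≫ toTriData.A g f (toTriData.I a)

namespace TriModData

variable {Obj : Type u} {Hom : Obj → Obj → Type u} [∀ a b, Bicategory.{u, u} (Hom a b)]
  (D : TriModData Obj Hom) {a b c d e z : Obj}

/-- `π ⊗ f`. -/
def πR (p : Hom d e) (q : Hom c d) (r : Hom b c) (s : Hom a b) (t : Hom z a) :
    D.m (D.m (D.A p q r) (𝟙 s)) (𝟙 t) ≫ D.m (D.A p (D.o q r) s) (𝟙 t) ≫
        D.m (D.m (𝟙 p) (D.A q r s)) (𝟙 t) ≅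
      D.m (D.A (D.o p q) r s) (𝟙 t) ≫ D.m (D.A p q (D.o r s)) (𝟙 t) :=
  (mapComp₃ (D.R e t) _ _ _).symm ≪≫ (D.R e t).map₂Iso (D.π p q r s) ≪≫ (D.R e t).mapComp _ _

/-- `p ⊗ π`. -/
def πL (p : Hom d e) (q : Hom c d) (r : Hom b c) (s : Hom a b) (t : Hom z a) :
    D.m (𝟙 p) (D.m (D.A q r s) (𝟙 t)) ≫ D.m (𝟙 p) (D.A q (D.o r s) t) ≫
        D.m (𝟙 p) (D.m (𝟙 q) (D.A r s t)) ≅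
      D.m (𝟙 p) (D.A (D.o q r) s t) ≫ D.m (𝟙 p) (D.A q r (D.o s t)) :=
  (mapComp₃ (D.L z p) _ _ _).symm ≪≫ (D.L z p).map₂Iso (D.π q r s t) ≪≫ (D.L z p).mapComp _ _

/-- `μ ⊗ f`. -/
def μR (h : Hom c d) (g : Hom b c) (f : Hom a b) :
    D.m (D.m (D.r' h) (𝟙 g)) (𝟙 f) ≫ D.m (D.A h (D.I c) g) (𝟙 f) ≫
        D.m (D.m (𝟙 h) (D.l g)) (𝟙 f) ≅ 𝟙 (D.o (D.o h g) f) :=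
  (mapComp₃ (D.R d f) _ _ _).symm ≪≫ (D.R d f).map₂Iso (D.μ h g) ≪≫ (D.R d f).mapId _

/-- `h ⊗ μ`. -/
def μL (h : Hom c d) (g : Hom b c) (f : Hom a b) :
    D.m (𝟙 h) (D.m (D.r' g) (𝟙 f)) ≫ D.m (𝟙 h) (D.A g (D.I b) f) ≫
        D.m (𝟙 h) (D.m (𝟙 g) (D.l f)) ≅ 𝟙 (D.o h (D.o g f)) :=
  (mapComp₃ (D.L a h) _ _ _).symm ≪≫ (D.L a h).map₂Iso (D.μ g f) ≪≫ (D.L a h).mapId _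

/-- `h ⊗ lam`. -/
def lamL (h : Hom c d) (g : Hom b c) (f : Hom a b) :
    D.m (𝟙 h) (D.m (D.l g) (𝟙 f)) ≅
      D.m (𝟙 h) (D.A (D.I c) g f) ≫ D.m (𝟙 h) (D.l (D.o g f)) :=
  (D.L a h).map₂Iso (D.lam g f) ≪≫ (D.L a h).mapComp _ _

/-- `rho ⊗ f`. -/
def rhoR (h : Hom c d) (g : Hom b c) (f : Hom a b) :
    D.m (D.m (𝟙 h) (D.r' g)) (𝟙 f) ≅
      D.m (D.r' (D.o h g)) (𝟙 f) ≫ D.m (D.A h g (D.I b)) (𝟙 f) :=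
  (D.R d f).map₂Iso (D.rho h g) ≪≫ (D.R d f).mapComp _ _

/-- `π` is a modification. -/
def PiNatural : Prop :=
  ∀ {a b c d e : Obj} {k k' : Hom d e} {h h' : Hom c d} {g g' : Hom b c} {f f' : Hom a b}
    (κ : k ⟶ k') (χ : h ⟶ h') (γ : g ⟶ g') (φ : f ⟶ f'),
    D.m (D.m (D.m κ χ) γ) φ ◁ (D.π k' h' g' f').hom ≫
        (paste (D.natA (D.m κ χ) γ φ) (D.natA κ χ (D.m γ φ))).hom =
      (paste (mapSq (D.comp a b e) (D.natA κ χ γ) (idSq φ))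
          (paste (D.natA κ (D.m χ γ) φ) (mapSq (D.comp a d e) (idSq κ) (D.natA χ γ φ)))).hom ≫
        (D.π k h g f).hom ▷ D.m κ (D.m χ (D.m γ φ))

/-- `μ` is a modification. -/
def MuNatural : Prop :=
  ∀ {a b c : Obj} {g g' : Hom b c} {f f' : Hom a b} (γ : g ⟶ g') (φ : f ⟶ f'),
    D.m γ φ ◁ (D.μ g' f').hom ≫ (idSq (D.m γ φ)).hom =
      (paste (mapSq (D.comp a b c) (D.natR' γ) (idSq φ))
          (paste (D.natA γ (D.ι b) φ) (mapSq (D.comp a b c) (idSq γ) (D.natL φ)))).hom ≫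
        (D.μ g f).hom ▷ D.m γ φ

/-- `lam` is a modification. -/
def LamNatural : Prop :=
  ∀ {a b c : Obj} {g g' : Hom b c} {f f' : Hom a b} (γ : g ⟶ g') (φ : f ⟶ f'),
    D.m (D.m (D.ι c) γ) φ ◁ (D.lam g' f').hom ≫
        (paste (D.natA (D.ι c) γ φ) (D.natL (D.m γ φ))).hom =
      (mapSq (D.comp a b c) (D.natL γ) (idSq φ)).hom ≫ (D.lam g f).hom ▷ D.m γ φ

/-- `rho` is a modification. -/
def RhoNatural : Prop :=
  ∀ {a b c : Obj} {g g' : Hom b c} {f f' : Hom a b} (γ : g ⟶ g') (φ : f ⟶ f'),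
    D.m γ φ ◁ (D.rho g' f').hom ≫ (paste (D.natR' (D.m γ φ)) (D.natA γ φ (D.ι a))).hom =
      (mapSq (D.comp a b c) (idSq γ) (D.natR' φ)).hom ≫
        (D.rho g f).hom ▷ D.m γ (D.m φ (D.ι a))

/-- The associativity axiom (nonabelian 4-cocycle condition): the two ways round the
associahedron agree. Here `⊗≫` is composition up to the constraints of a hom-bicategory. -/
def Cocycle : Prop :=
  ∀ {z a b c d e : Obj} (p : Hom d e) (q : Hom c d) (r : Hom b c) (s : Hom a b) (t : Hom z a),
    𝟙 (D.m (D.m (D.A p q r) (𝟙 s)) (𝟙 t) ≫ D.m (D.A p (D.o q r) s) (𝟙 t) ≫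
        D.m (D.m (𝟙 p) (D.A q r s)) (𝟙 t) ≫ D.A p (D.o q (D.o r s)) t ≫
        D.m (𝟙 p) (D.A q (D.o r s) t) ≫ D.m (𝟙 p) (D.m (𝟙 q) (D.A r s t))) ⊗≫
      (D.πR p q r s t).hom ▷ (D.A p (D.o q (D.o r s)) t ≫ D.m (𝟙 p) (D.A q (D.o r s) t) ≫
        D.m (𝟙 p) (D.m (𝟙 q) (D.A r s t))) ⊗≫
      D.m (D.A (D.o p q) r s) (𝟙 t) ◁ (D.π p q (D.o r s) t).hom ▷
        D.m (𝟙 p) (D.m (𝟙 q) (D.A r s t)) ⊗≫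
      (D.m (D.A (D.o p q) r s) (𝟙 t) ≫ D.A (D.o p q) (D.o r s) t) ◁
        (D.natA₃ p q (D.A r s t)).inv ⊗≫
      (D.π (D.o p q) r s t).hom ▷ D.A p q (D.o r (D.o s t)) ⊗≫
      𝟙 (D.A (D.o (D.o p q) r) s t ≫ D.A (D.o p q) r (D.o s t) ≫ D.A p q (D.o r (D.o s t))) =
    𝟙 (D.m (D.m (D.A p q r) (𝟙 s)) (𝟙 t) ≫ D.m (D.A p (D.o q r) s) (𝟙 t) ≫
        D.m (D.m (𝟙 p) (D.A q r s)) (𝟙 t) ≫ D.A p (D.o q (D.o r s)) t ≫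
        D.m (𝟙 p) (D.A q (D.o r s) t) ≫ D.m (𝟙 p) (D.m (𝟙 q) (D.A r s t))) ⊗≫
      (D.m (D.m (D.A p q r) (𝟙 s)) (𝟙 t) ≫ D.m (D.A p (D.o q r) s) (𝟙 t)) ◁
        (D.natA₂ p (D.A q r s) t).hom ▷
        (D.m (𝟙 p) (D.A q (D.o r s) t) ≫ D.m (𝟙 p) (D.m (𝟙 q) (D.A r s t))) ⊗≫
      (D.m (D.m (D.A p q r) (𝟙 s)) (𝟙 t) ≫ D.m (D.A p (D.o q r) s) (𝟙 t) ≫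
        D.A p (D.o (D.o q r) s) t) ◁ (D.πL p q r s t).hom ⊗≫
      D.m (D.m (D.A p q r) (𝟙 s)) (𝟙 t) ◁ (D.π p (D.o q r) s t).hom ▷
        D.m (𝟙 p) (D.A q r (D.o s t)) ⊗≫
      (D.natA₁ (D.A p q r) s t).hom ▷
        (D.A p (D.o q r) (D.o s t) ≫ D.m (𝟙 p) (D.A q r (D.o s t))) ⊗≫
      D.A (D.o (D.o p q) r) s t ◁ (D.π p q r (D.o s t)).hom ⊗≫
      𝟙 (D.A (D.o (D.o p q) r) s t ≫ D.A (D.o p q) r (D.o s t) ≫ D.A p q (D.o r (D.o s t)))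

/-- The left normalization axiom. -/
def LeftNormal : Prop :=
  ∀ {a b c d : Obj} (h : Hom c d) (g : Hom b c) (f : Hom a b),
    𝟙 (D.m (D.m (D.r' h) (𝟙 g)) (𝟙 f) ≫ D.m (D.A h (D.I c) g) (𝟙 f) ≫
        D.A h (D.o (D.I c) g) f ≫ D.m (𝟙 h) (D.A (D.I c) g f) ≫
        D.m (𝟙 h) (D.l (D.o g f))) ⊗≫
      D.m (D.m (D.r' h) (𝟙 g)) (𝟙 f) ◁ (D.π h (D.I c) g f).hom ▷ D.m (𝟙 h) (D.l (D.o g f)) ⊗≫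
      (D.natA₁ (D.r' h) g f).hom ▷
        (D.A h (D.I c) (D.o g f) ≫ D.m (𝟙 h) (D.l (D.o g f))) ⊗≫
      D.A h g f ◁ (D.μ h (D.o g f)).hom ⊗≫
      𝟙 (D.A h g f) =
    𝟙 (D.m (D.m (D.r' h) (𝟙 g)) (𝟙 f) ≫ D.m (D.A h (D.I c) g) (𝟙 f) ≫
        D.A h (D.o (D.I c) g) f ≫ D.m (𝟙 h) (D.A (D.I c) g f) ≫
        D.m (𝟙 h) (D.l (D.o g f))) ⊗≫
      (D.m (D.m (D.r' h) (𝟙 g)) (𝟙 f) ≫ D.m (D.A h (D.I c) g) (𝟙 f) ≫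
        D.A h (D.o (D.I c) g) f) ◁ (D.lamL h g f).inv ⊗≫
      (D.m (D.m (D.r' h) (𝟙 g)) (𝟙 f) ≫ D.m (D.A h (D.I c) g) (𝟙 f)) ◁
        (D.natA₂ h (D.l g) f).inv ⊗≫
      (D.μR h g f).hom ▷ D.A h g f ⊗≫
      𝟙 (D.A h g f)

/-- The right normalization axiom. -/
def RightNormal : Prop :=
  ∀ {a b c d : Obj} (h : Hom c d) (g : Hom b c) (f : Hom a b),
    𝟙 (D.m (D.r' (D.o h g)) (𝟙 f) ≫ D.m (D.A h g (D.I b)) (𝟙 f) ≫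
        D.A h (D.o g (D.I b)) f ≫ D.m (𝟙 h) (D.A g (D.I b) f) ≫
        D.m (𝟙 h) (D.m (𝟙 g) (D.l f))) ⊗≫
      D.m (D.r' (D.o h g)) (𝟙 f) ◁ (D.π h g (D.I b) f).hom ▷
        D.m (𝟙 h) (D.m (𝟙 g) (D.l f)) ⊗≫
      (D.m (D.r' (D.o h g)) (𝟙 f) ≫ D.A (D.o h g) (D.I b) f) ◁ (D.natA₃ h g (D.l f)).inv ⊗≫
      (D.μ (D.o h g) f).hom ▷ D.A h g f ⊗≫
      𝟙 (D.A h g f) =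
    𝟙 (D.m (D.r' (D.o h g)) (𝟙 f) ≫ D.m (D.A h g (D.I b)) (𝟙 f) ≫
        D.A h (D.o g (D.I b)) f ≫ D.m (𝟙 h) (D.A g (D.I b) f) ≫
        D.m (𝟙 h) (D.m (𝟙 g) (D.l f))) ⊗≫
      (D.rhoR h g f).inv ▷ (D.A h (D.o g (D.I b)) f ≫ D.m (𝟙 h) (D.A g (D.I b) f) ≫
        D.m (𝟙 h) (D.m (𝟙 g) (D.l f))) ⊗≫
      (D.natA₂ h (D.r' g) f).hom ▷ (D.m (𝟙 h) (D.A g (D.I b) f) ≫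
        D.m (𝟙 h) (D.m (𝟙 g) (D.l f))) ⊗≫
      D.A h g f ◁ (D.μL h g f).hom ⊗≫
      𝟙 (D.A h g f)

end TriModData

/-- Tricategories in the sense of Gordon, Power and Street, with the adjoint equivalences as part of
the structure, on a set `Obj` of 0-cells and hom-bicategories `Hom a b`. -/
structure Tricategory (Obj : Type u) (Hom : Obj → Obj → Type u)
    [∀ a b, Bicategory.{u, u} (Hom a b)] extends TriModData Obj Hom where
  pi_natural : toTriModData.PiNatural
  mu_natural : toTriModData.MuNatural
  lam_natural : toTriModData.LamNatural
  rho_natural : toTriModData.RhoNatural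
  cocycle : toTriModData.Cocycle
  left_normal : toTriModData.LeftNormal
  right_normal : toTriModData.RightNormal

section Gray

variable {A B C : Type u} [Bicategory.{u, u} A] [Bicategory.{u, u} B] [Bicategory.{u, u} C]

/-- An adjoint equivalence that is the identity. -/
def IsIdEquiv {x y : A} (e : Bicategory.Equivalence x y) : Prop :=
  ∃ h : x = y, e = h ▸ Bicategory.Equivalence.id x

/-- An isomorphism of 1-cells that is the identity. -/
def IsIdIso {x y : A} {f g : x ⟶ y} (e : f ≅ g) : Prop := ∃ h : f = g, e = eqToIso h

/-- Cubical pseudofunctors of two variables: strict on identities, and the comparison of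
`F (f, f') ≫ F (g, g')` with `F (f ≫ g, f' ≫ g')` is the identity if `f'` or `g` is. -/
structure IsCubical (F : (A × B) ⥤ᵖ C) : Prop where
  mapId : ∀ x : A × B, IsIdIso (F.mapId x)
  mapComp_left : ∀ {x y : A} {x' : B} {z : A × B} (f : x ⟶ y) (g : (y, x') ⟶ z),
    IsIdIso (F.mapComp (f ×ₘ 𝟙 x') g)
  mapComp_right : ∀ {x : A × B} {y : A} {y' z' : B} (f : x ⟶ (y, y')) (g : y' ⟶ z'),
    IsIdIso (F.mapComp f (𝟙 y ×ₘ g))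

end Gray

namespace Tricategory

variable {Obj : Type u} {Hom : Obj → Obj → Type u} [∀ a b, Bicategory.{u, u} (Hom a b)]

/-- Gray-categories: tricategories in which everything is strict except interchange, that is, the
hom-bicategories are 2-categories, composition is cubical, and the units and all the constraints are
identities. -/
structure IsGray (T : Tricategory Obj Hom) : Prop where
  strict : ∀ a b, Bicategory.Strict (Hom a b)
  comp : ∀ a b c, IsCubical (T.comp a b c)
  unit : ∀ a x, IsIdIso ((T.unit a).mapId x)
  assoc : ∀ a b c d, IsIdEquiv (T.assoc a b c d)
  left : ∀ a b, IsIdEquiv (T.left a b)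
  right : ∀ a b, IsIdEquiv (T.right a b)
  pi : ∀ {a b c d e : Obj} (k : Hom d e) (h : Hom c d) (g : Hom b c) (f : Hom a b),
    IsIdIso (T.π k h g f)
  mu : ∀ {a b c : Obj} (g : Hom b c) (f : Hom a b), IsIdIso (T.μ g f)
  lam : ∀ {a b c : Obj} (g : Hom b c) (f : Hom a b), IsIdIso (T.lam g f)
  rho : ∀ {a b c : Obj} (g : Hom b c) (f : Hom a b), IsIdIso (T.rho g f)

end Tricategory

namespace Tricategory

variable {Obj : Type u} {Hom : Obj → Obj → Type u} [∀ a b, Bicategory.{u, u} (Hom a b)]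

variable (Hom) in
/-- The `m`-cells of a tricategory. -/
def Cells : ℕ → Type u
  | 0 => Obj
  | 1 => Σ a b : Obj, Hom a b
  | 2 => Σ (a b : Obj) (f g : Hom a b), f ⟶ g
  | 3 => Σ (a b : Obj) (f g : Hom a b) (α β : f ⟶ g), α ⟶ β
  | _ + 4 => PEmpty

/-- A 2-cell as an element of the set of 2-cells. -/
def cell₂ {a b : Obj} {f g : Hom a b} (α : f ⟶ g) : Cells Hom 2 := ⟨a, b, f, g, α⟩

/-- A 3-cell as an element of the set of 3-cells. -/
def cell₃ {a b : Obj} {f g : Hom a b} {α β : f ⟶ g} (Φ : α ⟶ β) : Cells Hom 3 :=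
  ⟨a, b, f, g, α, β, Φ⟩

/-- The underlying reflexive globular set of a tricategory. -/
def toRGSet (T : Tricategory Obj Hom) : Penon.RGSet.{u} 3 where
  cells := Cells Hom
  isEmpty_cells {m} h := by
    obtain ⟨k, rfl⟩ : ∃ k, m = k + 4 := ⟨m - 4, by omega⟩
    exact inferInstanceAs (IsEmpty PEmpty)
  s {m} x := match m, x with
    | 0, ⟨a, _, _⟩ => a
    | 1, ⟨a, b, f, _, _⟩ => ⟨a, b, f⟩
    | 2, ⟨_, _, _, _, α, _, _⟩ => cell₂ α
  t {m} x := match m, x with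
    | 0, ⟨_, b, _⟩ => b
    | 1, ⟨a, b, _, g, _⟩ => ⟨a, b, g⟩
    | 2, ⟨_, _, _, _, _, β, _⟩ => cell₂ β
  i {m} h x := match m, h, x with
    | 0, _, a => ⟨a, a, T.I a⟩
    | 1, _, ⟨_, _, f⟩ => cell₂ (𝟙 f)
    | 2, _, ⟨_, _, _, _, α⟩ => cell₃ (𝟙 α)
  s_s {m} x := match m, x with
    | 0, _ => rfl
    | 1, _ => rfl
  t_s {m} x := match m, x with
    | 0, _ => rfl
    | 1, _ => rfl
  s_i {m} h x := match m, h, x with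
    | 0, _, _ => rfl
    | 1, _, _ => rfl
    | 2, _, _ => rfl
  t_i {m} h x := match m, h, x with
    | 0, _, _ => rfl
    | 1, _, _ => rfl
    | 2, _, _ => rfl

/-- A presentation of the tricategory `T` as the Penon 3-category `X`: an isomorphism between the
underlying reflexive globular sets that preserves the composition of 2-cells and of 3-cells inside
the hom-bicategories, that is, the composition of 2-cells along 1-cells, of 3-cells along 2-cells
and of 3-cells along 1-cells. Compatibility of the composition along 0-cells is not required (so
that it is a stronger statement that there is no presentation). -/
structure PenonPresentation (T : Tricategory Obj Hom) (X : (Penon.monad.{u} 3).Algebra) where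
  iso : T.toRGSet ≅ X.A
  map_comp₂ : ∀ {a b : Obj} {f g h : Hom a b} (α : f ⟶ g) (β : g ⟶ h),
    iso.hom.map (m := 2) (cell₂ (α ≫ β)) =
      Penon.algComp X 1 (iso.hom.map (m := 2) (cell₂ β)) (iso.hom.map (m := 2) (cell₂ α))
        (.map iso.hom (A := T.toRGSet) (m := 2) rfl)
  map_comp₃ : ∀ {a b : Obj} {f g : Hom a b} {α β γ : f ⟶ g} (Φ : α ⟶ β) (Ψ : β ⟶ γ),
    iso.hom.map (m := 3) (cell₃ (Φ ≫ Ψ)) =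
      Penon.algComp X 2 (iso.hom.map (m := 3) (cell₃ Ψ)) (iso.hom.map (m := 3) (cell₃ Φ))
        (.map iso.hom (A := T.toRGSet) (m := 3) rfl)
  map_hcomp₃ : ∀ {a b : Obj} {f g h : Hom a b} {α α' : f ⟶ g} {β β' : g ⟶ h} (Φ : α ⟶ α')
      (Ψ : β ⟶ β'),
    iso.hom.map (m := 3) (cell₃ (Φ ▷ β ≫ α' ◁ Ψ)) =
      Penon.algComp X 1 (iso.hom.map (m := 3) (cell₃ Ψ)) (iso.hom.map (m := 3) (cell₃ Φ))
        (.map iso.hom (A := T.toRGSet) (m := 3) rfl)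

/-- The tricategory `T` is (presented by) a Penon 3-category. -/
def IsPenon (T : Tricategory Obj Hom) : Prop :=
  ∃ X : (Penon.monad.{u} 3).Algebra, Nonempty (T.PenonPresentation X)

end Tricategory

end Tri

/-! There are two independent halves: the braid data form a Gray-category, and a Penon 3-category
obeys an Eckmann–Hilton identity that braids violate.

For the first half, recall that the 2-cells and 3-cells of the tricategory are the 1-cells and
2-cells of `BraidBicat`. A 1-cell of `BraidBicat` is determined by its number of strands and a
2-cell by its braid and end points, so a 2-cell with braid 1 (`Triv`) is an identity between equal
1-cells. All constraints except interchange are of this kind. The tensor product is associative and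
unital on the nose as a pseudofunctor (`tensor_assoc`, `unit_tensor`, `tensor_unit`); the substance
there is that interchange in a braided category is coherent with the associator (`tensorδ_assoc`).
The associativity and unit equivalences can therefore be identities, and their 1-cell components
have no strands. The cocycle and normalization axioms compare 2-cells between 1-cells without
strands, and `BraidGroup 0` is trivial. The naturality axioms of the four modifications involve
arbitrary 1-cells, but there interchange only moves strands past a 1-cell without strands, so every
factor has trivial braid (`Triv.tensor_mapComp`, `Triv.mapSq`).

For the second half, consider 3-cells that are endomorphisms of one 2-cell `α`, itself an
endomorphism of the identity of a 0-cell. In a strict 3-category composition along 1-cells commutes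
on them, by Eckmann–Hilton. In a magma with a contraction over a strict 3-category the two
composites are parallel with equal images, and parallel 3-cells with equal images are equal. So
commutativity holds in the free object, and the structure map carries it to every Penon 3-category.
In the tricategory of braids this composition is juxtaposition, and for a generator of `BraidGroup
2` and an identity braid commutativity would say `σ 0 = σ 2` in `BraidGroup 4`, which the underlying
permutations refute. -/

/-- The braid category as a bicategory with one object. -/
abbrev BraidBicat : Type := MonoidalSingleObj BraidCat

/-! ### Cells with trivial braid in the bicategory of braids -/

namespace BraidBicat

open Bicategory BraidGroup
open CategoryTheory.Prod

variable {a b c d : BraidBicat}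

/-- The number of strands of a 1-cell. -/
def strands (f : a ⟶ b) : ℕ := BraidCat.strands f

@[ext]
theorem hom_ext {f g : a ⟶ b} (h : strands f = strands g) : f = g := BraidCat.ext h

@[simp] theorem strands_id : strands (𝟙 a) = 0 := rfl

@[simp] theorem strands_comp (f : a ⟶ b) (g : b ⟶ c) :
    strands (f ≫ g) = strands f + strands g := rfl

theorem strands_eq {f g : a ⟶ b} (η : f ⟶ g) : strands f = strands g := BraidCat.Hom.eq η

/-- The 2-cells whose braid is the identity. -/
def Triv {f g : a ⟶ b} (η : f ⟶ g) : Prop := BraidCat.Hom.braid η = 1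

theorem Triv.eq {f g : a ⟶ b} {η θ : f ⟶ g} (hη : Triv η) (hθ : Triv θ) : η = θ :=
  BraidCat.hom_ext (hη.trans hθ.symm)

theorem Triv.id (f : a ⟶ b) : Triv (𝟙 f) := rfl

theorem Triv.eqToHom {f g : a ⟶ b} (h : f = g) : Triv (eqToHom h) := by
  subst h
  rfl

theorem Triv.comp {f g h : a ⟶ b} {η : f ⟶ g} {θ : g ⟶ h} (hη : Triv η) (hθ : Triv θ) :
    Triv (η ≫ θ) :=
  (BraidCat.comp_braid _ _).trans (by
    rw [show BraidCat.Hom.braid η = 1 from hη, show BraidCat.Hom.braid θ = 1 from hθ]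
    simp)

theorem Triv.whiskerLeft (f : a ⟶ b) {g h : b ⟶ c} {η : g ⟶ h} (hη : Triv η) : Triv (f ◁ η) :=
  (BraidCat.whiskerLeft_braid (m := f) η).trans (by
    rw [show BraidCat.Hom.braid η = 1 from hη, map_one])

theorem Triv.whiskerRight {f g : a ⟶ b} {η : f ⟶ g} (hη : Triv η) (h : b ⟶ c) : Triv (η ▷ h) :=
  (BraidCat.whiskerRight_braid η (n := h)).trans (by
    rw [show BraidCat.Hom.braid η = 1 from hη, map_one])

/-- A 2-cell exists only between equal 1-cells, so after substitution `e` can be compared with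
`Iso.refl`. -/
theorem Triv.inv {f g : a ⟶ b} {e : f ≅ g} (he : Triv e.hom) : Triv e.inv := by
  obtain rfl : f = g := hom_ext (strands_eq e.hom)
  obtain rfl : e = Iso.refl f := Iso.ext (he.eq (.id f))
  exact .id f

theorem Triv.associator (f : a ⟶ b) (g : b ⟶ c) (h : c ⟶ d) : Triv (α_ f g h).hom := rfl

theorem Triv.leftUnitor (f : a ⟶ b) : Triv (λ_ f).hom := rfl

theorem Triv.rightUnitor (f : a ⟶ b) : Triv (ρ_ f).hom := rfl

/-- The braid group on no strands has no generators. This settles every axiom whose 1-cells are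
composites of constraint components, whatever the pasting diagrams look like. -/
theorem Triv.of_strands_eq_zero {f g : a ⟶ b} (η : f ⟶ g) (h : strands f = 0) : Triv η := by
  -- The number of strands is only propositionally 0, hence the generalization over `n`.
  have key : ∀ (n : ℕ) (_ : n = 0) (b : BraidGroup n), b = 1 := by
    rintro _ rfl b
    have : MonoidHom.id (BraidGroup 0) = 1 := BraidGroup.hom_ext fun i hi => by omega
    exact DFunLike.congr_fun this b
  exact key _ h _

theorem isIdIso_of_triv {f g : a ⟶ b} {e : f ≅ g} (he : Triv e.hom) : IsIdIso e := by
  obtain rfl : f = g := hom_ext (strands_eq e.hom)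
  exact ⟨rfl, Iso.ext (he.eq (.id f))⟩

instance : Bicategory.Strict BraidBicat where
  id_comp _ := hom_ext (zero_add _)
  comp_id _ := hom_ext (add_zero _)
  assoc _ _ _ := hom_ext (add_assoc _ _ _)
  leftUnitor_eqToIso f := Iso.ext ((Triv.leftUnitor f).eq (Triv.eqToHom (hom_ext (zero_add _))))
  rightUnitor_eqToIso f := Iso.ext ((Triv.rightUnitor f).eq (Triv.eqToHom (hom_ext (add_zero _))))
  associator_eqToIso f g h := Iso.ext ((Triv.associator f g h).eq
    (Triv.eqToHom (hom_ext (add_assoc _ _ _))))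

/-! ### Equality of pseudofunctors into the bicategory of braids -/

/-- Equality of 2-cells up to composition with 2-cells whose braid is the identity. All the hom-sets
of `BraidBicat` are the same, so it makes sense for 2-cells between different objects. -/
def Sim {f g : a ⟶ b} {f' g' : c ⟶ d} (η : f ⟶ g) (η' : f' ⟶ g') : Prop :=
  ∃ (u : (show a ⟶ b from f) ⟶ (show a ⟶ b from f'))
    (v : (show a ⟶ b from g) ⟶ (show a ⟶ b from g')),
    Triv u ∧ Triv v ∧ η ≫ v = u ≫ (show (show a ⟶ b from f') ⟶ (show a ⟶ b from g') from η')

/-- Once the end points agree, the two mediating cells are endomorphisms with trivial braid, that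
is, identities. -/
theorem Sim.eq {f g : a ⟶ b} {η θ : f ⟶ g} (h : Sim η θ) : η = θ := by
  obtain ⟨u, v, hu, hv, h⟩ := h
  obtain rfl := hu.eq (.id f)
  obtain rfl := hv.eq (.id g)
  exact (Category.comp_id η).symm.trans (h.trans (Category.id_comp θ))

theorem Sim.of_triv {f g f' g' : a ⟶ b} {η : f ⟶ g} {η' : f' ⟶ g'} (hη : Triv η) (hη' : Triv η')
    (h : strands f = strands f') : Sim η η' := by
  obtain rfl : f = f' := hom_ext h
  refine ⟨𝟙 f, eqToHom (hom_ext ((strands_eq η).symm.trans (strands_eq η'))), .id f, .eqToHom _, ?_⟩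
  exact (hη.comp (.eqToHom _)).eq ((Triv.id f).comp hη')

variable {B B' : Type} [Bicategory.{0, 0} B] [Bicategory.{0, 0} B']

/-- The fields are identified in order of dependency: the values of `F` and `G` on 2-cells have a
common type only after their values on 1-cells have been identified. Phrasing the hypotheses with
`Sim` avoids transports, and lets associators and unitors serve as mediating cells, so that ordinary
naturality squares can be fed in. -/
theorem pseudofunctor_ext {F G : B ⥤ᵖ BraidBicat}
    (map : ∀ {x y : B} (f : x ⟶ y), strands (F.map f) = strands (G.map f))
    (map₂ : ∀ {x y : B} {f g : x ⟶ y} (η : f ⟶ g), Sim (F.map₂ η) (G.map₂ η))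
    (mapId : ∀ x : B, Triv (F.mapId x).hom ∧ Triv (G.mapId x).hom)
    (mapComp : ∀ {x y z : B} (f : x ⟶ y) (g : y ⟶ z), Sim (F.mapComp f g).hom (G.mapComp f g).hom) :
    F = G := by
  obtain ⟨⟨⟨⟨Fo, Fm⟩, Fm₂⟩, _, _⟩, Fi, Fc, _, _, _, _, _⟩ := F
  obtain ⟨⟨⟨⟨Go, Gm⟩, Gm₂⟩, _, _⟩, Gi, Gc, _, _, _, _, _⟩ := G
  dsimp only at map map₂ mapId mapComp
  obtain rfl : Fo = Go := funext fun _ => PUnit.ext _ _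
  obtain rfl : @Fm = @Gm := by
    funext x y f
    exact hom_ext (map f)
  obtain rfl : @Fm₂ = @Gm₂ := by
    funext x y f g η
    exact (map₂ η).eq
  obtain rfl : Fi = Gi := by
    funext x
    exact Iso.ext ((mapId x).1.eq (mapId x).2)
  obtain rfl : @Fc = @Gc := by
    funext x y z f g
    exact Iso.ext (mapComp f g).eq
  rfl

open scoped Pseudofunctor.StrongTrans

/-- The identity as an equivalence between equal objects of a bicategory. -/
def equivOfEq {A : Type*} [Bicategory A] {x y : A} (h : x = y) : Bicategory.Equivalence x y :=
  h ▸ Bicategory.Equivalence.id x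

theorem isIdEquiv_equivOfEq {A : Type} [Bicategory.{0, 0} A] {x y : A} (h : x = y) :
    IsIdEquiv (equivOfEq h) :=
  ⟨h, rfl⟩

/-- A transport along an equality of pseudofunctors does not reduce. This lemma and the next three
extract all that is needed about it: its components have no strands and its naturality cells have
trivial braid. Both are visible as soon as the equality is substituted. -/
theorem strands_equivOfEq_hom_app {F G : B ⥤ᵖ BraidBicat} (h : F = G) (x : B) :
    strands ((equivOfEq h).hom.app x) = 0 := by
  subst h
  rfl

theorem strands_equivOfEq_inv_app {F G : B ⥤ᵖ BraidBicat} (h : F = G) (x : B) :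
    strands ((equivOfEq h).inv.app x) = 0 := by
  subst h
  rfl

theorem triv_equivOfEq_hom_naturality {F G : B ⥤ᵖ BraidBicat} (h : F = G) {x y : B} (f : x ⟶ y) :
    Triv ((equivOfEq h).hom.naturality f).hom := by
  subst h
  exact (Triv.rightUnitor _).comp (Triv.leftUnitor _).inv

theorem triv_equivOfEq_inv_naturality {F G : B ⥤ᵖ BraidBicat} (h : F = G) {x y : B} (f : x ⟶ y) :
    Triv ((equivOfEq h).inv.naturality f).hom := by
  subst h
  exact (Triv.rightUnitor _).comp (Triv.leftUnitor _).inv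

theorem Triv.comp_mapComp {F : B ⥤ᵖ B'} {G : B' ⥤ᵖ BraidBicat} {x y z : B} {f : x ⟶ y} {g : y ⟶ z}
    (h : Triv (G.map₂ (F.mapComp f g).hom)) (h' : Triv (G.mapComp (F.map f) (F.map g)).hom) :
    Triv ((F.comp G).mapComp f g).hom :=
  Triv.comp h h'

/-! ### Where interchange is trivial -/

/-- Composition along 0-cells. -/
abbrev tensor : (BraidBicat × BraidBicat) ⥤ᵖ BraidBicat := braidedComp BraidCat

theorem Triv.tensor_map₂ {x y : BraidBicat × BraidBicat} {f g : x ⟶ y} {η : f ⟶ g}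
    (h₁ : Triv η.1) (h₂ : Triv η.2) : Triv (tensor.map₂ η) :=
  (BraidCat.tensorHom_braid η.1 η.2).trans (by
    rw [show BraidCat.Hom.braid η.1 = 1 from h₁, show BraidCat.Hom.braid η.2 = 1 from h₂,
      map_one, map_one, mul_one]
    rfl)

theorem Triv.tensor_mapId (x : BraidBicat × BraidBicat) : Triv (tensor.mapId x).hom := rfl

theorem block_zero_left {n o : ℕ} : ∀ k : ℕ, (block o 0 k : BraidGroup n) = 1
  | 0 => rfl
  | k + 1 => by rw [block, block_zero_left k, cross, mul_one]

/-- The only nontrivial factor of interchange is the braiding of the inner pair `f.2`, `g.1`, and a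
block crossing with no strands on one side is empty. This is the cubical property of the tensor
product. -/
theorem Triv.tensor_mapComp {x y z : BraidBicat × BraidBicat} (f : x ⟶ y) (g : y ⟶ z)
    (h : strands f.2 = 0 ∨ strands g.1 = 0) : Triv (tensor.mapComp f g).hom := by
  -- The inverse is `tensorμ`, which contains the braiding itself, so its braid is the word `block`.
  suffices h : Triv (tensor.mapComp f g).inv from Triv.inv (e := (tensor.mapComp f g).symm) h
  have hβ : Triv (a := y.1) (b := y.2) (BraidCat.braid f.2 g.1).hom := by
    refine (BraidCat.braid_hom_braid _ _).trans ?_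
    rcases h with h | h
    · rw [show BraidCat.strands f.2 = 0 from h, block_zero_left]
    · rw [show BraidCat.strands g.1 = 0 from h]
      rfl
  refine Triv.comp (Triv.associator _ _ _) (.comp (.whiskerLeft _ (.inv (.associator _ _ _)))
    (.comp (.whiskerLeft _ (.whiskerRight hβ _)) (.comp (.whiskerLeft _ (.associator _ _ _))
      (.inv (.associator _ _ _)))))

end BraidBicat

/-! ### Strict associativity and unitality of the tensor product -/

section

open MonoidalCategory

universe v u

variable {C : Type u} [Category.{v} C] [MonoidalCategory C] [BraidedCategory C]

/-- This is `associator_monoidal` for `tensorμ` with the interchanges inverted: `h₁` and `h₂` cancel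
the `tensorμ` on the two sides of it. -/
theorem tensorδ_assoc (X₁ X₂ X₃ Y₁ Y₂ Y₃ : C) :
    (tensorδ X₁ X₂ Y₁ Y₂ ▷ (X₃ ⊗ Y₃) ≫ tensorδ (X₁ ⊗ X₂) X₃ (Y₁ ⊗ Y₂) Y₃) ≫
        ((α_ X₁ X₂ X₃).hom ⊗ₘ (α_ Y₁ Y₂ Y₃).hom) =
      (α_ (X₁ ⊗ Y₁) (X₂ ⊗ Y₂) (X₃ ⊗ Y₃)).hom ≫
        (X₁ ⊗ Y₁) ◁ tensorδ X₂ X₃ Y₂ Y₃ ≫ tensorδ X₁ (X₂ ⊗ X₃) Y₁ (Y₂ ⊗ Y₃) := by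
  have h₁ : (tensorδ X₁ X₂ Y₁ Y₂ ▷ (X₃ ⊗ Y₃) ≫ tensorδ (X₁ ⊗ X₂) X₃ (Y₁ ⊗ Y₂) Y₃) ≫
      tensorμ (X₁ ⊗ X₂) X₃ (Y₁ ⊗ Y₂) Y₃ ≫ tensorμ X₁ X₂ Y₁ Y₂ ▷ (X₃ ⊗ Y₃) = 𝟙 _ := by
    rw [Category.assoc, tensorδ_tensorμ_assoc, ← comp_whiskerRight, tensorδ_tensorμ,
      id_whiskerRight]
  have h₂ : (tensorμ X₁ (X₂ ⊗ X₃) Y₁ (Y₂ ⊗ Y₃) ≫ (X₁ ⊗ Y₁) ◁ tensorμ X₂ X₃ Y₂ Y₃) ≫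
      (X₁ ⊗ Y₁) ◁ tensorδ X₂ X₃ Y₂ Y₃ ≫ tensorδ X₁ (X₂ ⊗ X₃) Y₁ (Y₂ ⊗ Y₃) = 𝟙 _ := by
    rw [Category.assoc, ← whiskerLeft_comp_assoc, tensorμ_tensorδ, whiskerLeft_id,
      Category.id_comp, tensorμ_tensorδ]
  have h₃ := associator_monoidal X₁ X₂ X₃ Y₁ Y₂ Y₃
  rw [← Category.comp_id (_ ⊗ₘ _), ← h₂, ← Category.assoc (_ ⊗ₘ _), ← h₃]
  rw [← Category.assoc (tensorμ (X₁ ⊗ X₂) X₃ (Y₁ ⊗ Y₂) Y₃), Category.assoc,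
    Category.assoc, Category.assoc (tensorμ (X₁ ⊗ X₂) X₃ (Y₁ ⊗ Y₂) Y₃), reassoc_of% h₁]

end

namespace BraidBicat

open Bicategory BraidGroup
open CategoryTheory.Prod

/-- The mediating cells are associators of the monoidal category, which have trivial braid. On
2-cells the required square is naturality of the associator, and on composition comparisons it is
`tensorδ_assoc`. -/
theorem tensor_assoc :
    (prodMap tensor (.id BraidBicat)).comp tensor =
      (prodAssoc BraidBicat BraidBicat BraidBicat).comp
        ((prodMap (.id BraidBicat) tensor).comp tensor) := by
  refine pseudofunctor_ext (fun f => add_assoc _ _ _) (fun {x y f g} η => ?_) (fun x => ⟨?_, ?_⟩)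
    (fun {x y z} f g => ?_)
  · exact ⟨(MonoidalCategory.associator (C := BraidCat) f.1.1 f.1.2 f.2).hom,
      (MonoidalCategory.associator (C := BraidCat) g.1.1 g.1.2 g.2).hom,
      Triv.associator _ _ _, Triv.associator _ _ _,
      MonoidalCategory.associator_naturality (C := BraidCat) η.1.1 η.1.2 η.2⟩
  · exact Triv.of_strands_eq_zero _ rfl
  · exact Triv.of_strands_eq_zero _ rfl
  · let G := (prodMap (.id BraidBicat) tensor).comp tensor
    -- Reassociation is strict, so it contributes only the image of an identity to the comparison.
    have h : (((prodAssoc BraidBicat BraidBicat BraidBicat).comp G).mapComp f g).hom =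
        (G.mapComp (f.1.1 ×ₘ (f.1.2 ×ₘ f.2)) (g.1.1 ×ₘ (g.1.2 ×ₘ g.2))).hom :=
      (congrArg (· ≫ _) (G.map₂_id _)).trans (Category.id_comp _)
    refine ⟨_, _, Triv.associator _ _ _, Triv.tensor_map₂ (η := (α_ _ _ _).hom ×ₘ (α_ _ _ _).hom)
      (Triv.associator f.1.1 f.1.2 f.2) (Triv.associator g.1.1 g.1.2 g.2), ?_⟩
    rw [h]
    exact tensorδ_assoc (C := BraidCat) f.1.1 f.1.2 f.2 g.1.1 g.1.2 g.2

/-- The unit 1-cell. -/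
def unit : OneBicat.{0} ⥤ᵖ BraidBicat where
  obj _ := MonoidalSingleObj.star _
  map _ := 𝟙 _
  map₂ _ := 𝟙 _
  mapId _ := Iso.refl _
  mapComp _ _ := (λ_ _).symm
  map₂_whisker_left _ _ _ _ := (Triv.id _).eq
    (.comp (.inv (.leftUnitor _)) (.comp (.whiskerLeft _ (.id _)) (.leftUnitor _)))
  map₂_whisker_right _ _ := (Triv.id _).eq
    (.comp (.inv (.leftUnitor _)) (.comp (.whiskerRight (.id _) _) (.leftUnitor _)))
  map₂_associator _ _ _ := Triv.eq (.of_strands_eq_zero _ rfl) (.of_strands_eq_zero _ rfl)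
  map₂_left_unitor _ := Triv.eq (.of_strands_eq_zero _ rfl) (.of_strands_eq_zero _ rfl)
  map₂_right_unitor _ := Triv.eq (.of_strands_eq_zero _ rfl) (.of_strands_eq_zero _ rfl)

/-- The unit has no strands to cross, so the comparison has trivial braid, like that of the identity
pseudofunctor; on 2-cells the square is naturality of the left unitor. -/
theorem unit_tensor :
    (Bicategory.Prod.sectR OneBicat.star BraidBicat).toPseudofunctor.comp
      ((prodMap unit (.id BraidBicat)).comp tensor) = .id BraidBicat := by
  refine pseudofunctor_ext (fun f => zero_add _) (fun {x y f g} η => ?_) (fun x => ⟨?_, ?_⟩)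
    (fun {x y z} f g => ?_)
  · exact ⟨_, _, Triv.leftUnitor _, Triv.leftUnitor _,
      MonoidalCategory.leftUnitor_naturality (C := BraidCat) η⟩
  · exact Triv.of_strands_eq_zero _ rfl
  · exact Triv.of_strands_eq_zero _ rfl
  · refine .of_triv (.comp_mapComp ?_ (.comp_mapComp ?_ (.tensor_mapComp _ _ (.inr rfl))))
      (.id _) (zero_add _)
    · refine Triv.tensor_map₂ (η := (prodMap unit (.id BraidBicat)).map₂ _) (Triv.id _) ?_
      exact Triv.id (f ≫ g)
    · refine Triv.tensor_map₂ (Triv.of_strands_eq_zero _ rfl) ?_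
      exact Triv.id (f ≫ g)

theorem tensor_unit :
    (Bicategory.Prod.sectL BraidBicat OneBicat.star).toPseudofunctor.comp
      ((prodMap (.id BraidBicat) unit).comp tensor) = .id BraidBicat := by
  refine pseudofunctor_ext (fun f => add_zero _) (fun {x y f g} η => ?_) (fun x => ⟨?_, ?_⟩)
    (fun {x y z} f g => ?_)
  · exact ⟨_, _, Triv.rightUnitor _, Triv.rightUnitor _,
      MonoidalCategory.rightUnitor_naturality (C := BraidCat) η⟩
  · exact Triv.of_strands_eq_zero _ rfl
  · exact Triv.of_strands_eq_zero _ rfl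
  · refine .of_triv (.comp_mapComp ?_ (.comp_mapComp ?_ (.tensor_mapComp _ _ (.inl rfl))))
      (.id _) (add_zero _)
    · refine Triv.tensor_map₂ (η := (prodMap (.id BraidBicat) unit).map₂ _) ?_ (Triv.id _)
      exact Triv.id (f ≫ g)
    · refine Triv.tensor_map₂ ?_ (Triv.of_strands_eq_zero _ rfl)
      exact Triv.id (f ≫ g)

/-! ### Pastings of squares with trivial braid -/

section Squares

variable {x₀ x₁ x₂ y₀ y₁ y₂ : BraidBicat}

theorem Triv.paste {f : x₀ ⟶ y₀} {f' : x₁ ⟶ y₁} {f'' : x₂ ⟶ y₂} {x : x₀ ⟶ x₁}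
    {x' : x₁ ⟶ x₂} {y : y₀ ⟶ y₁} {y' : y₁ ⟶ y₂} {S : f ≫ y ≅ x ≫ f'} {T : f' ≫ y' ≅ x' ≫ f''}
    (hS : Triv S.hom) (hT : Triv T.hom) : Triv (paste S T).hom :=
  .comp (.inv (.associator _ _ _)) (.comp (.whiskerRight hS _) (.comp (.associator _ _ _)
    (.comp (.whiskerLeft _ hT) (.inv (.associator _ _ _)))))

theorem Triv.idSq (f : x₀ ⟶ x₁) : Triv (idSq f).hom :=
  .comp (.rightUnitor f) (.inv (.leftUnitor f))

/-- The image square contains two interchanges, one crossing `g` with `q` and one crossing `r` with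
`f'`. The conditions on `q` and `r` make both trivial; in the applications these are constraint
components, unit cells or identities. -/
theorem Triv.mapSq {x x' y y' : BraidBicat} {f : x ⟶ y} {f' : x' ⟶ y'} {p : x ⟶ x'} {q : y ⟶ y'}
    {z z' w w' : BraidBicat} {g : z ⟶ w} {g' : z' ⟶ w'} {r : z ⟶ z'} {s : w ⟶ w'}
    {S : f ≫ q ≅ p ≫ f'} {T : g ≫ s ≅ r ≫ g'} (hS : Triv S.hom) (hT : Triv T.hom)
    (hq : strands q = 0) (hr : strands r = 0) : Triv (mapSq tensor S T).hom :=
  .comp (.inv (.tensor_mapComp (f ×ₘ g) (q ×ₘ s) (.inr hq)))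
    (.comp (.tensor_map₂ hS hT) (.tensor_mapComp (p ×ₘ r) (f' ×ₘ g') (.inl hr)))

end Squares

/-! ### The tricategory of braids and its axioms -/

open scoped Pseudofunctor.StrongTrans

/-- The composition, units and constraint equivalences of the tricategory of braids. -/
def triData : TriData Unit (fun _ _ => BraidBicat) where
  comp _ _ _ := tensor
  unit _ := unit
  assoc _ _ _ _ := equivOfEq tensor_assoc
  left _ _ := equivOfEq unit_tensor
  right _ _ := equivOfEq tensor_unit

section

variable {a b c d : Unit}

theorem strands_m {g g' f f' : BraidBicat} (γ : g ⟶ g') (φ : f ⟶ f') :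
    strands (triData.m (a := a) (b := b) (c := c) γ φ) = strands γ + strands φ := rfl

theorem strands_A (h g f : BraidBicat) :
    strands (triData.A (a := a) (b := b) (c := c) (d := d) h g f) = 0 :=
  strands_equivOfEq_hom_app tensor_assoc _

theorem strands_l (f : BraidBicat) : strands (triData.l (a := a) (b := b) f) = 0 :=
  strands_equivOfEq_hom_app unit_tensor _

theorem strands_r' (f : BraidBicat) : strands (triData.r' (a := a) (b := b) f) = 0 :=
  strands_equivOfEq_inv_app tensor_unit _

theorem triv_natA {h h' g g' f f' : BraidBicat} (χ : h ⟶ h') (γ : g ⟶ g') (φ : f ⟶ f') :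
    Triv (triData.natA (a := a) (b := b) (c := c) (d := d) χ γ φ).hom :=
  triv_equivOfEq_hom_naturality tensor_assoc _

theorem triv_natL {f f' : BraidBicat} (φ : f ⟶ f') :
    Triv (triData.natL (a := a) (b := b) φ).hom :=
  triv_equivOfEq_hom_naturality unit_tensor _

theorem triv_natR' {f f' : BraidBicat} (φ : f ⟶ f') :
    Triv (triData.natR' (a := a) (b := b) φ).hom :=
  triv_equivOfEq_inv_naturality tensor_unit _

end

/-- The data of the tricategory of braids: the four modifications are identities. -/
abbrev triModData : TriModData Unit (fun _ _ => BraidBicat) where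
  toTriData := triData
  -- The two sides of each modification are composites of constraint components and identities, so
  -- they have no strands and are equal 1-cells.
  π k h g f := eqToIso (hom_ext (by simp only [strands_comp, strands_m, strands_A, strands_id]))
  μ g f := eqToIso (hom_ext (by
    simp only [strands_comp, strands_m, strands_A, strands_l, strands_r', strands_id]))
  lam g f := eqToIso (hom_ext (by
    simp only [strands_comp, strands_m, strands_A, strands_l, strands_id]))
  rho g f := eqToIso (hom_ext (by
    simp only [strands_comp, strands_m, strands_A, strands_r', strands_id]))

section

variable {a b c d e : Unit}

theorem triv_π (k h g f : BraidBicat) :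
    Triv (triModData.π (a := a) (b := b) (c := c) (d := d) (e := e) k h g f).hom :=
  .of_strands_eq_zero _ (by simp only [strands_comp, strands_m, strands_A, strands_id])

theorem triv_μ (g f : BraidBicat) :
    Triv (triModData.μ (a := a) (b := b) (c := c) g f).hom :=
  .of_strands_eq_zero _ (by
    simp only [strands_comp, strands_m, strands_A, strands_l, strands_r', strands_id])

theorem triv_lam (g f : BraidBicat) :
    Triv (triModData.lam (a := a) (b := b) (c := c) g f).hom :=
  .of_strands_eq_zero _ (by simp only [strands_m, strands_l, strands_id])

theorem triv_rho (g f : BraidBicat) :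
    Triv (triModData.rho (a := a) (b := b) (c := c) g f).hom :=
  .of_strands_eq_zero _ (by simp only [strands_m, strands_r', strands_id])

end

/-- The tricategory of braids. -/
def tricategory : Tricategory Unit (fun _ _ => BraidBicat) where
  toTriModData := triModData
  -- The 2-cells `κ`, `χ`, `γ`, `φ` may have strands, so the braids are shown to be trivial factor
  -- by factor. In each `mapSq` the two sides that could cause a crossing are a component of `A` and
  -- an identity.
  pi_natural κ χ γ φ :=
    Triv.eq (.comp (.whiskerLeft _ (triv_π _ _ _ _)) (.paste (triv_natA _ _ _) (triv_natA _ _ _)))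
      (.comp (.paste (.mapSq (triv_natA _ _ _) (.idSq _) (strands_A _ _ _) rfl)
        (.paste (triv_natA _ _ _) (.mapSq (.idSq _) (triv_natA _ _ _) rfl (strands_A _ _ _))))
        (.whiskerRight (triv_π _ _ _ _) _))
  mu_natural γ φ :=
    Triv.eq (.comp (.whiskerLeft _ (triv_μ _ _)) (.idSq _))
      (.comp (.paste (.mapSq (triv_natR' _) (.idSq _) (strands_r' _) rfl)
        (.paste (triv_natA _ _ _) (.mapSq (.idSq _) (triv_natL _) rfl (strands_l _))))
        (.whiskerRight (triv_μ _ _) _))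
  lam_natural γ φ :=
    Triv.eq (.comp (.whiskerLeft _ (triv_lam _ _)) (.paste (triv_natA _ _ _) (triv_natL _)))
      (.comp (.mapSq (triv_natL _) (.idSq _) (strands_l _) rfl) (.whiskerRight (triv_lam _ _) _))
  rho_natural γ φ :=
    Triv.eq (.comp (.whiskerLeft _ (triv_rho _ _)) (.paste (triv_natR' _) (triv_natA _ _ _)))
      (.comp (.mapSq (.idSq _) (triv_natR' _) rfl (strands_r' _)) (.whiskerRight (triv_rho _ _) _))
  -- Source and target 1-cells have no strands, so any two parallel 2-cells between them coincide;
  -- the two normalization axioms hold for the same reason.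
  cocycle p q r s t := by
    refine Triv.eq (.of_strands_eq_zero _ ?_) (.of_strands_eq_zero _ ?_) <;>
    simp only [strands_comp, strands_m, strands_A, strands_id]
  left_normal h g f := by
    refine Triv.eq (.of_strands_eq_zero _ ?_) (.of_strands_eq_zero _ ?_) <;>
    simp only [strands_comp, strands_m, strands_A, strands_l, strands_r', strands_id]
  right_normal h g f := by
    refine Triv.eq (.of_strands_eq_zero _ ?_) (.of_strands_eq_zero _ ?_) <;>
    simp only [strands_comp, strands_m, strands_A, strands_l, strands_r', strands_id]

theorem tricategory_isGray : tricategory.IsGray where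
  strict _ _ := inferInstanceAs (Bicategory.Strict BraidBicat)
  comp _ _ _ :=
    { mapId := fun x => isIdIso_of_triv (.tensor_mapId x)
      mapComp_left := fun _ _ => isIdIso_of_triv (.tensor_mapComp _ _ (.inl rfl))
      mapComp_right := fun _ _ => isIdIso_of_triv (.tensor_mapComp _ _ (.inr rfl)) }
  unit _ _ := ⟨rfl, rfl⟩
  assoc _ _ _ _ := isIdEquiv_equivOfEq tensor_assoc
  left _ _ := isIdEquiv_equivOfEq unit_tensor
  right _ _ := isIdEquiv_equivOfEq tensor_unit
  pi _ _ _ _ := isIdIso_of_triv (triv_π _ _ _ _)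
  mu _ _ := isIdIso_of_triv (triv_μ _ _)
  lam _ _ := isIdIso_of_triv (triv_lam _ _)
  rho _ _ := isIdIso_of_triv (triv_rho _ _)

end BraidBicat

/-! ### The Eckmann–Hilton argument, from strict to Penon 3-categories -/

namespace Penon

universe u

namespace StrictCat

variable {n : ℕ} (B : StrictCat.{u} n)

/-- Eckmann–Hilton: composition along `1`-cells is commutative on the `3`-cells whose `1`-dimensional
source and target are the identity of a `0`-cell. -/
theorem comp_one_comm (hn : 3 ≤ n) (y x : B.cells 3) (e : B.cells 0)
    (hys : B.s (B.s y) = B.i (by omega) e) (hyt : B.t (B.t y) = B.i (by omega) e)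
    (hxs : B.s (B.s x) = B.i (by omega) e) (hxt : B.t (B.t x) = B.i (by omega) e)
    (h : B.Composable 1 3 y x) (h' : B.Composable 1 3 x y) :
    B.comp 1 y x h = B.comp 1 x y h' := by
  -- The iterated identity of `e` is a unit for `y` and `x` both along 1-cells and along 0-cells,
  -- because their 1-dimensional boundaries are the identity of `e`.
  set E : B.cells 3 := B.i (by omega) (B.i (by omega) (B.i (by omega) e)) with hE
  have e1 : ∀ z : B.cells 3, B.s (B.s z) = B.i (by omega) e → B.idS 1 3 hn z = E := by
    intro z hz
    simp [RGSet.idS, hz, hE]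
  have e2 : ∀ z : B.cells 3, B.t (B.t z) = B.i (by omega) e → B.idT 1 3 hn z = E := by
    intro z hz
    simp [RGSet.idT, hz, hE]
  have e3 : ∀ z : B.cells 3, B.s (B.s z) = B.i (by omega) e → B.idS 0 3 hn z = E := by
    intro z hz
    simp [RGSet.idS, hz, hE, B.s_i]
  have e4 : ∀ z : B.cells 3, B.t (B.t z) = B.i (by omega) e → B.idT 0 3 hn z = E := by
    intro z hz
    simp [RGSet.idT, hz, hE, B.t_i]
  have c1 : ∀ z w : B.cells 3, B.s (B.s z) = B.i (by omega) e → B.t (B.t w) = B.i (by omega) e →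
      B.Composable 1 3 z w := by
    intro z w hz hw
    simp [RGSet.Composable, hz, hw]
  have c0 : ∀ z w : B.cells 3, B.s (B.s z) = B.i (by omega) e → B.t (B.t w) = B.i (by omega) e →
      B.Composable 0 3 z w := by
    intro z w hz hw
    simp [RGSet.Composable, hz, hw, B.s_i, B.t_i]
  have hEs : B.s (B.s E) = B.i (by omega) e := by simp [hE, B.s_i]
  have hEt : B.t (B.t E) = B.i (by omega) e := by simp [hE, B.t_i]
  have r1 : ∀ (z : B.cells 3) (hz : B.s (B.s z) = B.i (by omega) e),
      B.comp 1 z E (c1 _ _ hz hEt) = z := by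
    intro z hz
    have := B.comp_id 1 hn z (by rw [e1 z hz]; exact c1 _ _ hz hEt)
    exact (B.comp_congr 1 rfl (e1 z hz).symm _ _).trans this
  have l1 : ∀ (z : B.cells 3) (hz : B.t (B.t z) = B.i (by omega) e),
      B.comp 1 E z (c1 _ _ hEs hz) = z := by
    intro z hz
    have := B.id_comp 1 hn z (by rw [e2 z hz]; exact c1 _ _ hEs hz)
    exact (B.comp_congr 1 (e2 z hz).symm rfl _ _).trans this
  have r0 : ∀ (z : B.cells 3) (hz : B.s (B.s z) = B.i (by omega) e),
      B.comp 0 z E (c0 _ _ hz hEt) = z := by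
    intro z hz
    have := B.comp_id 0 hn z (by rw [e3 z hz]; exact c0 _ _ hz hEt)
    exact (B.comp_congr 0 rfl (e3 z hz).symm _ _).trans this
  have l0 : ∀ (z : B.cells 3) (hz : B.t (B.t z) = B.i (by omega) e),
      B.comp 0 E z (c0 _ _ hEs hz) = z := by
    intro z hz
    have := B.id_comp 0 hn z (by rw [e4 z hz]; exact c0 _ _ hEs hz)
    exact (B.comp_congr 0 (e4 z hz).symm rfl _ _).trans this
  -- Write `y ∘₀ x` as `(y ∘₁ E) ∘₀ (E ∘₁ x)`; interchange gives `y ∘₁ x`.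
  have left : B.comp 0 y x (c0 _ _ hys hxt) = B.comp 1 y x h := by
    have := B.interchange (p := 0) (k := 1) (by omega) y E E x (c1 _ _ hys hEt) (c1 _ _ hEs hxt)
      (by rw [r1 y hys, l1 x hxt]; exact c0 _ _ hys hxt) (c0 _ _ hys hEt) (c0 _ _ hEs hxt)
      (by rw [r0 y hys, l0 x hxt]; exact h)
    rwa [B.comp_congr 0 (r1 y hys) (l1 x hxt) _ (c0 _ _ hys hxt),
      B.comp_congr 1 (r0 y hys) (l0 x hxt) _ h] at this
  -- Write the same cell as `(E ∘₁ y) ∘₀ (x ∘₁ E)`; interchange now gives `x ∘₁ y`.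
  have right : B.comp 0 y x (c0 _ _ hys hxt) = B.comp 1 x y h' := by
    have := B.interchange (p := 0) (k := 1) (by omega) E y x E (c1 _ _ hEs hyt) (c1 _ _ hxs hEt)
      (by rw [l1 y hyt, r1 x hxs]; exact c0 _ _ hys hxt) (c0 _ _ hEs hxt) (c0 _ _ hys hEt)
      (by rw [l0 x hxt, r0 y hys]; exact h')
    rwa [B.comp_congr 0 (l1 y hyt) (r1 x hxs) _ (c0 _ _ hys hxt),
      B.comp_congr 1 (l0 x hxt) (r0 y hys) _ h'] at this
  rw [← left, right]

end StrictCat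

/-- In an object of `Q 3`, composition along `1`-cells is commutative on the endomorphisms of a
`2`-cell that is itself an endomorphism of the identity of a `0`-cell. -/
theorem Q.comp_one_comm (E : Q.{u} 3) (y x : E.A.cells 3) (α : E.A.cells 2) (e : E.A.cells 0)
    (hys : E.A.s y = α) (hyt : E.A.t y = α) (hxs : E.A.s x = α) (hxt : E.A.t x = α)
    (hs : E.A.s α = E.A.i (by omega) e) (ht : E.A.t α = E.A.i (by omega) e)
    (h : E.A.Composable 1 3 y x) (h' : E.A.Composable 1 3 x y) :
    E.A.comp 1 y x h = E.A.comp 1 x y h' := by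
  have hα : E.A.Composable 1 2 α α := by simp [RGSet.Composable, hs, ht]
  -- Both composites are endomorphisms of `α ∘₁ α`, hence parallel; this is where a common `α`
  -- matters. In the top dimension the contraction turns equality of images into equality, so the
  -- strict case suffices.
  refine E.con.eq_of_top _ _ ⟨?_, ?_⟩ ?_
  · rw [E.A.s_comp (by omega) y x h (by rwa [hys, hxs]),
      E.A.s_comp (by omega) x y h' (by rwa [hys, hxs])]
    exact E.A.comp_congr 1 (hys.trans hxs.symm) (hxs.trans hys.symm) _ _
  · rw [E.A.t_comp (by omega) y x h (by rwa [hyt, hxt]),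
      E.A.t_comp (by omega) x y h' (by rwa [hyt, hxt])]
    exact E.A.comp_congr 1 (hyt.trans hxt.symm) (hxt.trans hyt.symm) _ _
  · rw [E.f.map_comp, E.f.map_comp]
    refine E.B.comp_one_comm le_rfl _ _ (E.f.map e) ?_ ?_ ?_ ?_ _ _ <;>
    simp only [← E.f.map_s, ← E.f.map_t, ← E.f.map_i, hys, hyt, hxs, hxt, hs, ht]

/-- In a Penon `3`-category, composition along `1`-cells is commutative on the endomorphisms of a
`2`-cell that is itself an endomorphism of the identity of a `0`-cell. -/
theorem algComp_one_comm (X : (monad.{u} 3).Algebra) (y x : X.A.cells 3) (α : X.A.cells 2)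
    (e : X.A.cells 0) (hys : X.A.s y = α) (hyt : X.A.t y = α) (hxs : X.A.s x = α)
    (hxt : X.A.t x = α) (hs : X.A.s α = X.A.i (by omega) e) (ht : X.A.t α = X.A.i (by omega) e)
    (h : X.A.Composable 1 3 y x) (h' : X.A.Composable 1 3 x y) :
    algComp X 1 y x h = algComp X 1 x y h' := by
  let η : RGSet.Hom X.A ((Q.forget 3).leftAdjoint.obj X.A).A.toRGSet := (monad 3).η.app X.A
  -- The composites of generators already agree in the free object, so neither algebra law is
  -- needed.
  refine congrArg X.a.map (Q.comp_one_comm _ _ _ (η.map α) (η.map e) ?_ ?_ ?_ ?_ ?_ ?_ _ _)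
  · exact (η.map_s y).symm.trans (congrArg η.map hys)
  · exact (η.map_t y).symm.trans (congrArg η.map hyt)
  · exact (η.map_s x).symm.trans (congrArg η.map hxs)
  · exact (η.map_t x).symm.trans (congrArg η.map hxt)
  -- Reflexivity enters here: the unit of the monad preserves identities, so the boundary of `η.map
  -- α` is an identity of the free magma and not merely a generator.
  · exact (η.map_s α).symm.trans ((congrArg η.map hs).trans (η.map_i _ e))
  · exact (η.map_t α).symm.trans ((congrArg η.map ht).trans (η.map_i _ e))

end Penon

/-! ### Telling braid generators apart -/

namespace BraidGroup

/-- The permutation of the strands of a braid. -/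
def toPerm (n : ℕ) : BraidGroup n →* Equiv.Perm ℕ :=
  PresentedGroup.toGroup (f := fun i => Equiv.swap i.1 (i.1 + 1)) (by
    rintro r (⟨i, j, hij⟩ | ⟨i, j, hij⟩)
    · simp only [map_mul, map_inv, FreeGroup.lift_apply_of, mul_inv_eq_one]
      ext x
      simp only [Equiv.Perm.mul_apply, Equiv.swap_apply_def]
      grind
    · simp only [map_mul, map_inv, FreeGroup.lift_apply_of, mul_inv_eq_one, ← hij]
      ext x
      simp only [Equiv.Perm.mul_apply, Equiv.swap_apply_def]
      grind)

theorem toPerm_σ {n i : ℕ} (h : i + 1 < n) : toPerm n (σ i) = Equiv.swap i (i + 1) := by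
  rw [σ, dif_pos h]
  exact PresentedGroup.toGroup.of _

/-- Evaluate the underlying permutations at `i`: the first gives `i + 1`, and the transposition of
`j` and `j + 1` sends `i` to `i + 1` only if `j = i`. -/
theorem σ_injective {n i j : ℕ} (hi : i + 1 < n) (hj : j + 1 < n) (h : (σ i : BraidGroup n) = σ j) :
    i = j := by
  have := congrArg (fun b => toPerm n b i) h
  simp only [toPerm_σ hi, toPerm_σ hj, Equiv.swap_apply_def] at this
  grind

end BraidGroup

/-! ### The obstruction to being a Penon 3-category -/

namespace Tricategory

universe u

theorem cell₃_injective {Obj : Type u} {Hom : Obj → Obj → Type u}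
    [∀ a b, Bicategory.{u, u} (Hom a b)] {a b : Obj} {f g : Hom a b} {α β : f ⟶ g} :
    Function.Injective (cell₃ (α := α) (β := β)) := by
  intro Φ Ψ h
  cases h
  rfl

/-- In a tricategory that is a Penon `3`-category, the horizontal composition of the endomorphisms
of an endomorphism of a unit is commutative. -/
theorem IsPenon.hcomp_comm {Obj : Type u} {Hom : Obj → Obj → Type u}
    [∀ a b, Bicategory.{u, u} (Hom a b)] {T : Tricategory Obj Hom} (hT : T.IsPenon) {a : Obj}
    {α : T.I a ⟶ T.I a} (Φ Ψ : α ⟶ α) :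
    Bicategory.whiskerRight Φ α ≫ Bicategory.whiskerLeft α Ψ =
      Bicategory.whiskerRight Ψ α ≫ Bicategory.whiskerLeft α Φ := by
  obtain ⟨X, ⟨P⟩⟩ := hT
  have key : (cell₃ (Bicategory.whiskerRight Φ α ≫ Bicategory.whiskerLeft α Ψ) : Cells Hom 3) =
      cell₃ (Bicategory.whiskerRight Ψ α ≫ Bicategory.whiskerLeft α Φ) := by
    -- The equation can be tested in the Penon 3-category, where `map_hcomp₃` turns both sides into
    -- composites along 1-cells.
    have inj : Function.Injective (P.iso.hom.map (m := 3)) := by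
      refine Function.LeftInverse.injective (g := P.iso.inv.map (m := 3)) fun x => ?_
      exact congrArg (fun f : T.toRGSet ⟶ T.toRGSet => f.map x) P.iso.hom_inv_id
    refine inj ((P.map_hcomp₃ Φ Ψ).trans (Eq.trans ?_ (P.map_hcomp₃ Ψ Φ).symm))
    refine Penon.algComp_one_comm X _ _ (P.iso.hom.map (A := T.toRGSet) (m := 2) (cell₂ α))
      (P.iso.hom.map (A := T.toRGSet) (m := 0) a) ?_ ?_ ?_ ?_ ?_ ?_ _ _
    · exact (P.iso.hom.map_s _).symm
    · exact (P.iso.hom.map_t _).symm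
    · exact (P.iso.hom.map_s _).symm
    · exact (P.iso.hom.map_t _).symm
    -- The identity of the 0-cell `a` in the globular set is the unit `T.I a`, so the boundary of
    -- `α` is carried to the identity of a 0-cell.
    · exact (P.iso.hom.map_s _).symm.trans (P.iso.hom.map_i (A := T.toRGSet) (m := 0) (by omega) a)
    · exact (P.iso.hom.map_t _).symm.trans (P.iso.hom.map_i (A := T.toRGSet) (m := 0) (by omega) a)
  exact cell₃_injective key

end Tricategory

namespace BraidBicat

/-- Two strands are the fewest that carry a nontrivial braid. With `Φ` the crossing and `𝟙 α` as the
other cell, commutativity says that a crossing to the left of two straight strands equals one to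
their right, that is, `σ 0 = σ 2` on four strands. Only conjugation by the braiding relates these
two braids. -/
theorem not_isPenon_tricategory : ¬ tricategory.IsPenon := fun h => by
  let α : BraidCat := ⟨2⟩
  let Φ : α ⟶ α := ⟨rfl, BraidGroup.σ 0⟩
  have key : MonoidalCategory.whiskerRight Φ α ≫ MonoidalCategory.whiskerLeft α (𝟙 α) =
      MonoidalCategory.whiskerRight (𝟙 α) α ≫ MonoidalCategory.whiskerLeft α Φ :=
    h.hcomp_comm (a := ()) (α := α) Φ (𝟙 α)
  rw [MonoidalCategory.whiskerLeft_id, MonoidalCategory.id_whiskerRight, Category.comp_id,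
    Category.id_comp] at key
  have hb := congrArg BraidCat.Hom.braid key
  rw [BraidCat.whiskerRight_braid, BraidCat.whiskerLeft_braid] at hb
  change BraidGroup.emb 0 4 _ (BraidGroup.σ 0 : BraidGroup 2) =
    BraidGroup.emb 2 4 _ (BraidGroup.σ 0 : BraidGroup 2) at hb
  rw [BraidGroup.emb_σ _ (by omega), BraidGroup.emb_σ _ (by omega)] at hb
  have := BraidGroup.σ_injective (n := 4) (by omega) (by omega) hb
  omega

end BraidBicat

theorem mainTheorem3 :
    ∃ T : Tricategory Unit (fun _ _ => MonoidalSingleObj BraidCat),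
      T.comp () () () = braidedComp BraidCat ∧ T.IsGray ∧ ¬ T.IsPenon :=
  ⟨BraidBicat.tricategory, rfl, BraidBicat.tricategory_isGray,
    BraidBicat.not_isPenon_tricategory⟩
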